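/- A locally compact hypergroup is a locally compact Hausdorff space $K$ with a bilinear, associative, weakly continuous convolution $*$ on the space $M(K)$ of bounded regular complex Borel measures, determined by the measures $\delta_x*\delta_y$ through $\int f\,d(\mu*\nu)=\int\!\!\int f(x*y)\,d\mu(x)\,d\nu(y)$, where $f(x*y)=\int f\,d(\delta_x*\delta_y)$, and such that: each $\delta_x*\delta_y$ is a regular probability measure with compact support; $(x,y)\mapsto\delta_x*\delta_y$ is weakly continuous; $(x,y)\mapsto\operatorname{supp}(\delta_x*\delta_y)$ is continuous for the Michael (Vietoris) topology on nonempty compact sets; there is an identity $e$ with $\delta_e*\delta_x=\delta_x*\delta_e=\delta_x$; and there is a continuous involution $x\mapsto\check x$ such that the image of $\delta_x*\delta_y$ under it is $\delta_{\check y}*\delta_{\check x}$, and $e\in\operatorname{supp}(\delta_x*\delta_y)$ if and only if $x=\check y$. Let $K$ be a locally compact hypergroup with a left-invariant Haar measure $\omega$, that is, a nonzero positive Radon measure with $\delta_x*\omega=\omega$ for all $x\in K$, and let $L^\infty(K)=L^\infty(K,\omega;\mathbb{C})$ with pointwise multiplication. Let $\sigma$ be a regular Borel probability measure on $K$ that is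 non-degenerate: $\bigcup_{n\ge 1}(\operatorname{supp}\sigma)^n$ is dense in $K$, where $A*B=\bigcup_{a\in A,\,b\in B}\operatorname{supp}(\delta_a*\delta_b)$ for $A,B\subseteq K$. Put $$(\sigma*f)(x)=\int_K f(\check y*x)\,d\sigma(y),\qquad H^\infty_\sigma(K)=\{f\in L^\infty(K):\ \sigma*f=f\}.$$ Then the following conditions are equivalent. (i) $H^\infty_\sigma(K)$ is a subalgebra of $L^\infty(K)$. (ii) $H^\infty_\sigma(K)=\mathbb{C}1$. -/

import Mathlib

open MeasureTheory TopologicalSpace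
open scoped ENNReal BoundedContinuousFunction

noncomputable section

/-! ### The algebra `L^∞` -/

namespace LInfty

variable {X : Type*} [MeasurableSpace X] (ω : Measure X)

/-- The pointwise (almost everywhere) product on `L^∞`. -/
instance instMul : Mul (Lp ℂ ∞ ω) where
  mul f g := ((Lp.memLp g).mul' (Lp.memLp f) : MemLp (fun x => f x * g x) ∞ ω).toLp

/-- The unit of `L^∞` is the class of the constant function `1`. -/
instance instOne : One (Lp ℂ ∞ ω) where
  one := (memLp_top_const (1 : ℂ) : MemLp (fun _ : X => (1 : ℂ)) ∞ ω).toLp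

variable {ω}

theorem coeFn_mul (f g : Lp ℂ ∞ ω) : ⇑(f * g) =ᵐ[ω] fun x => f x * g x :=
  MemLp.coeFn_toLp ((Lp.memLp g).mul' (Lp.memLp f) : MemLp (fun x => f x * g x) ∞ ω)

theorem coeFn_one : ⇑(1 : Lp ℂ ∞ ω) =ᵐ[ω] fun _ => 1 :=
  MemLp.coeFn_toLp (memLp_top_const (1 : ℂ) : MemLp (fun _ : X => (1 : ℂ)) ∞ ω)

variable (ω)

/-- `L^∞` is a commutative ring, with its usual additive structure. -/
instance instCommRing : CommRing (Lp ℂ ∞ ω) where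
  __ := (inferInstance : AddCommGroup (Lp ℂ ∞ ω))
  mul := (· * ·)
  one := 1
  mul_assoc f g h := Lp.ext <| by
    filter_upwards [coeFn_mul (f * g) h, coeFn_mul f g, coeFn_mul f (g * h), coeFn_mul g h]
      with x h1 h2 h3 h4
    rw [h1, h2, h3, h4, mul_assoc]
  mul_comm f g := Lp.ext <| by
    filter_upwards [coeFn_mul f g, coeFn_mul g f] with x h1 h2
    rw [h1, h2, mul_comm]
  one_mul f := Lp.ext <| by
    filter_upwards [coeFn_mul 1 f, coeFn_one (ω := ω)] with x h1 h2
    rw [h1, h2, one_mul]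
  mul_one f := Lp.ext <| by
    filter_upwards [coeFn_mul f 1, coeFn_one (ω := ω)] with x h1 h2
    rw [h1, h2, mul_one]
  zero_mul f := Lp.ext <| by
    filter_upwards [coeFn_mul 0 f, Lp.coeFn_zero ℂ ∞ ω] with x h1 h2
    rw [h1, h2, Pi.zero_apply, zero_mul]
  mul_zero f := Lp.ext <| by
    filter_upwards [coeFn_mul f 0, Lp.coeFn_zero ℂ ∞ ω] with x h1 h2
    rw [h1, h2, Pi.zero_apply, mul_zero]
  left_distrib f g h := Lp.ext <| by
    filter_upwards [coeFn_mul f (g + h), Lp.coeFn_add g h, Lp.coeFn_add (f * g) (f * h),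
      coeFn_mul f g, coeFn_mul f h] with x h1 h2 h3 h4 h5
    rw [h1, h2, h3, Pi.add_apply, Pi.add_apply, h4, h5, mul_add]
  right_distrib f g h := Lp.ext <| by
    filter_upwards [coeFn_mul (f + g) h, Lp.coeFn_add f g, Lp.coeFn_add (f * h) (g * h),
      coeFn_mul f h, coeFn_mul g h] with x h1 h2 h3 h4 h5
    rw [h1, h2, h3, Pi.add_apply, Pi.add_apply, h4, h5, add_mul]

theorem smul_mul' (c : ℂ) (f g : Lp ℂ ∞ ω) : c • f * g = c • (f * g) := Lp.ext <| by
  filter_upwards [coeFn_mul (c • f) g, Lp.coeFn_smul c f, Lp.coeFn_smul c (f * g), coeFn_mul f g]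
    with x h1 h2 h3 h4
  rw [h1, h2, h3, Pi.smul_apply, Pi.smul_apply, h4, smul_mul_assoc]

/-- `L^∞` is a complex algebra, with its usual scalar multiplication. -/
instance instAlgebra : Algebra ℂ (Lp ℂ ∞ ω) :=
  Algebra.ofModule (smul_mul' ω) fun c f g => by
    rw [mul_comm, smul_mul' ω, mul_comm g f]

end LInfty

/-! ### Locally compact hypergroups -/

/-- A hypergroup structure on a locally compact Hausdorff space `K`: `conv x y` is the measure
`δ_x * δ_y`. The bilinear, weakly continuous convolution of arbitrary bounded regular measures
is determined by these measures through `⟨μ * ν, f⟩ = ∫∫ ⟨δ_x * δ_y, f⟩ dμ(x) dν(y)`. -/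
class Hypergroup (K : Type*) [TopologicalSpace K] [T2Space K] [LocallyCompactSpace K]
    [MeasurableSpace K] [BorelSpace K] where
  /-- the convolution `δ_x * δ_y` of two point masses -/
  conv : K → K → ProbabilityMeasure K
  /-- the identity -/
  e : K
  /-- the involution `x ↦ x̌` -/
  inv : K → K
  regular_conv : ∀ x y, (conv x y : Measure K).Regular
  /-- `(x, y) ↦ δ_x * δ_y` is weakly continuous. -/
  continuous_conv : Continuous fun p : K × K => conv p.1 p.2
  /-- `(δ_x * δ_y) * δ_z = δ_x * (δ_y * δ_z)`. -/
  conv_assoc : ∀ (x y z : K) (f : K →ᵇ ℂ),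
    ∫ t, ∫ s, f s ∂(conv t z : Measure K) ∂(conv x y : Measure K) =
      ∫ t, ∫ s, f s ∂(conv x t : Measure K) ∂(conv y z : Measure K)
  /-- The supports are nonempty and compact, and they depend continuously on `(x, y)` for the
  Michael (Vietoris) topology. -/
  continuous_supp : ∃ S : K × K → NonemptyCompacts K, Continuous S ∧
    ∀ x y, (S (x, y) : Set K) = (conv x y : Measure K).support
  e_conv : ∀ x, (conv e x : Measure K) = Measure.dirac x
  conv_e : ∀ x, (conv x e : Measure K) = Measure.dirac x
  continuous_inv : Continuous inv
  inv_inv : ∀ x, inv (inv x) = x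
  map_inv_conv : ∀ x y, (conv x y : Measure K).map inv = (conv (inv y) (inv x) : Measure K)
  e_mem_support_iff : ∀ x y, e ∈ (conv x y : Measure K).support ↔ x = inv y

namespace Hypergroup

variable {K : Type*} [TopologicalSpace K] [T2Space K] [LocallyCompactSpace K]
  [MeasurableSpace K] [BorelSpace K] [Hypergroup K]

/-- `f(x * y) = ∫ f d(δ_x * δ_y)`. -/
def trans (f : K → ℂ) (x y : K) : ℂ := ∫ t, f t ∂(conv x y : Measure K)

/-- `(μ * f)(x) = ∫ f(y̌ * x) dμ(y)`. -/
def convFun (μ : Measure K) (f : K → ℂ) (x : K) : ℂ := ∫ y, trans f (inv y) x ∂μ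

/-- A left-invariant Haar measure: a nonzero positive Radon measure `ω` with `δ_x * ω = ω` for all
`x`, that is, `∫ f(x * y) dω(y) = ∫ f dω` for every continuous `f` with compact support. -/
structure IsLeftHaar (ω : Measure K) : Prop where
  regular : ω.Regular
  ne_zero : ω ≠ 0
  left_inv : ∀ (x : K) (f : K → ℂ), Continuous f → HasCompactSupport f →
    ∫ y, trans f x y ∂ω = ∫ y, f y ∂ω

/-- The product of subsets, `A * B = ⋃ supp (δ_a * δ_b)` over `a ∈ A`, `b ∈ B`. -/
def setMul (A B : Set K) : Set K := ⋃ a ∈ A, ⋃ b ∈ B, (conv a b : Measure K).support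

/-- The powers `A ^ n`, where `A ^ 0 = {e}`. -/
def setPow (A : Set K) : ℕ → Set K
  | 0 => {e}
  | n + 1 => setMul (setPow A n) A

/-- A positive measure is non-degenerate if `⋃ (supp μ) ^ n`, over `n ≥ 1`, is dense in `K`. -/
def IsNondegenerate (μ : Measure K) : Prop :=
  closure (⋃ n ≥ 1, setPow μ.support n) = Set.univ

/-- The space `H^∞_σ(K)` of all `f ∈ L^∞(K)` with `σ * f = f` in `L^∞(K)`. -/
def harmonicLInfty (ω σ : Measure K) : Set (Lp ℂ ∞ ω) :=
  {f | convFun σ f =ᵐ[ω] f}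

end Hypergroup

end

/-!
Smoothing a bounded `σ`-harmonic function `f` by a continuous compactly supported density yields a
continuous bounded `F` with `F x = ∫ F d(σ̌ * δ_x)` at every point. If the harmonic functions form
an algebra, then `|F|²`, the product of `F` with its harmonic conjugate, is again harmonic. Hence
the variance of `F` under the probability measure `σ̌ * δ_x` vanishes and `F` is constant on its
support; non-degeneracy of `σ` then makes `F` constant. Smoothing along an approximate identity,
the functional `ψ ↦ ∫ ψ f dω` is a limit of multiples of the Haar integral, so `f` is constant.
-/

open Filter Set
open scoped Topology NNReal ComplexConjugate

section RegularMeasure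

variable {X Y : Type*} [TopologicalSpace X] [MeasurableSpace X] [TopologicalSpace Y]
  [MeasurableSpace Y] {μ : Measure X} {ν : Measure Y} {χ : ℕ → X → ℝ} {ξ : ℕ → Y → ℝ}

theorem exists_isCompact_lt_measure_of_isSigmaCompact {F : Set X} (hF : IsSigmaCompact F)
    {μ : Measure X} {r : ℝ≥0∞} (hr : r < μ F) : ∃ Q ⊆ F, IsCompact Q ∧ r < μ Q := by
  obtain ⟨Q, hQ, rfl⟩ := hF
  rw [measure_iUnion_eq_iSup_accumulate] at hr
  obtain ⟨n, hn⟩ := lt_iSup_iff.1 hr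
  exact ⟨accumulate Q n, accumulate_subset_iUnion n, isCompact_accumulate hQ n, hn⟩

/-- A sequence of compactly supported continuous cutoff functions that converge to `1` almost
everywhere. It reduces integrals of bounded continuous functions to compact supports, where the
limit and Fubini theorems hold without any countability assumption on the space. -/
structure IsCutoffSeq (μ : Measure X) (χ : ℕ → X → ℝ) : Prop where
  continuous : ∀ n, Continuous (χ n)
  hasCompactSupport : ∀ n, HasCompactSupport (χ n)
  mem_Icc : ∀ n x, χ n x ∈ Icc (0 : ℝ) 1
  ae_tendsto : ∀ᵐ x ∂μ, Tendsto (fun n => χ n x) atTop (𝓝 1)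

namespace IsCutoffSeq

theorem norm_mul_le (hχ : IsCutoffSeq μ χ) (n : ℕ) (x : X) (c : ℝ) : ‖χ n x * c‖ ≤ ‖c‖ := by
  rw [norm_mul, Real.norm_of_nonneg (hχ.mem_Icc n x).1]
  exact mul_le_of_le_one_left (norm_nonneg c) (hχ.mem_Icc n x).2

variable [OpensMeasurableSpace X] [OpensMeasurableSpace Y]

theorem tendsto_integral_one_sub [IsFiniteMeasure μ] (hχ : IsCutoffSeq μ χ) :
    Tendsto (fun n => ∫ x, (1 - χ n x) ∂μ) atTop (𝓝 0) := by
  have h := tendsto_integral_of_dominated_convergence (μ := μ) (F := fun n x => 1 - χ n x)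
    (f := fun _ => 0) (fun _ => 1)
    (fun n => (continuous_const.sub (hχ.continuous n)).aestronglyMeasurable)
    (integrable_const 1) (fun n => .of_forall fun x => ?_) ?_
  · simpa using h
  · rw [Real.norm_of_nonneg (sub_nonneg.2 (hχ.mem_Icc n x).2)]
    exact sub_le_self 1 (hχ.mem_Icc n x).1
  · filter_upwards [hχ.ae_tendsto] with x hx
    simpa using hx.const_sub 1

theorem tendstoUniformly_integral_mul [IsFiniteMeasure ν] (hξ : IsCutoffSeq ν ξ) {P : Type*}
    {G : P → Y → ℝ} (hG : ∀ p, Continuous (G p)) {M : ℝ} (hM : ∀ p y, ‖G p y‖ ≤ M) :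
    TendstoUniformly (fun n p => ∫ y, ξ n y * G p y ∂ν) (fun p => ∫ y, G p y ∂ν) atTop := by
  have hsub : ∀ n, Integrable (fun y => 1 - ξ n y) ν := fun n =>
    (integrable_const 1).sub ((hξ.continuous n).integrable_of_hasCompactSupport
      (hξ.hasCompactSupport n))
  have hint : ∀ f : Y → ℝ, Continuous f → (∀ y, ‖f y‖ ≤ M) → Integrable f ν := fun f hf hfM =>
    Integrable.of_bound hf.aestronglyMeasurable M (.of_forall hfM)
  have hdist : ∀ n p, dist (∫ y, G p y ∂ν) (∫ y, ξ n y * G p y ∂ν) ≤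
      (∫ y, (1 - ξ n y) ∂ν) * M := fun n p => by
    rw [dist_eq_norm, ← integral_sub (hint _ (hG p) (hM p)) (hint (fun y => ξ n y * G p y)
      ((hξ.continuous n).mul (hG p)) fun y => (hξ.norm_mul_le n y _).trans (hM p y)),
      ← integral_mul_const]
    refine norm_integral_le_of_norm_le ((hsub n).mul_const M) (.of_forall fun y => ?_)
    have h0 : 0 ≤ 1 - ξ n y := sub_nonneg.2 (hξ.mem_Icc n y).2
    rw [← one_sub_mul, norm_mul, Real.norm_of_nonneg h0]
    exact mul_le_mul_of_nonneg_left (hM p y) h0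
  have hlim : Tendsto (fun n => (∫ y, (1 - ξ n y) ∂ν) * M) atTop (𝓝 0) := by
    simpa using hξ.tendsto_integral_one_sub.mul_const M
  refine Metric.tendstoUniformly_iff.2 fun ε hε => ?_
  filter_upwards [hlim.eventually_lt_const hε] with n hn p
  exact (hdist n p).trans_lt hn

theorem continuous_integral_mul [IsFiniteMeasureOnCompacts ν] (hξ : IsCutoffSeq ν ξ) {P : Type*}
    [TopologicalSpace P] {G : P → Y → ℝ} (hG : Continuous G.uncurry) (n : ℕ) :
    Continuous fun p => ∫ y, ξ n y * G p y ∂ν := by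
  rw [← continuousOn_univ]
  refine continuousOn_integral_of_compact_support (hξ.hasCompactSupport n).isCompact
    (((hξ.continuous n).comp continuous_snd).mul hG).continuousOn fun p y _ hy => ?_
  rw [image_eq_zero_of_notMem_tsupport hy, zero_mul]

theorem tendsto_integral_integral_mul [IsFiniteMeasure μ] [IsFiniteMeasure ν]
    (hχ : IsCutoffSeq μ χ) (hξ : IsCutoffSeq ν ξ)
    {G : X → Y → ℝ} (hG : Continuous G.uncurry) {M : ℝ} (hM : ∀ x y, ‖G x y‖ ≤ M) :
    Tendsto (fun n => ∫ x, ∫ y, χ n x * (ξ n y * G x y) ∂ν ∂μ) atTop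
      (𝓝 (∫ x, ∫ y, G x y ∂ν ∂μ)) := by
  have hξM : ∀ n x y, ‖ξ n y * G x y‖ ≤ M := fun n x y => (hξ.norm_mul_le n y _).trans (hM x y)
  simp only [integral_const_mul]
  refine tendsto_integral_of_dominated_convergence (fun _ => M * ν.real univ)
    (fun n => ((hχ.continuous n).mul
      (hξ.continuous_integral_mul hG n)).aestronglyMeasurable)
    (integrable_const _) (fun n => .of_forall fun x => ?_) ?_
  · exact (hχ.norm_mul_le n x _).trans (norm_integral_le_of_norm_le_const (.of_forall (hξM n x)))
  · filter_upwards [hχ.ae_tendsto] with x hx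
    simpa using hx.mul ((hξ.tendstoUniformly_integral_mul
      (fun x => hG.comp (Continuous.prodMk_right x)) hM).tendsto_at x)

end IsCutoffSeq

variable [T2Space X] [BorelSpace X] [T2Space Y] [BorelSpace Y]

theorem exists_isSigmaCompact_subset_measure_sdiff_eq_zero (μ : Measure X)
    [μ.InnerRegularCompactLTTop] {A : Set X} (hA : MeasurableSet A) (hμA : μ A ≠ ∞) :
    ∃ F ⊆ A, IsSigmaCompact F ∧ μ (A \ F) = 0 := by
  choose Q hQA hQ hμQ using fun n : ℕ =>
    hA.exists_isCompact_sdiff_lt (μ := μ) hμA (ENNReal.inv_ne_zero.2 (ENNReal.natCast_ne_top n))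
  refine ⟨⋃ n, Q n, iUnion_subset hQA, isSigmaCompact_iUnion_of_isCompact Q hQ, ?_⟩
  refine le_antisymm (ge_of_tendsto' ENNReal.tendsto_inv_nat_nhds_zero fun n => ?_) (zero_le)
  exact (measure_mono (sdiff_subset_sdiff_right (subset_iUnion Q n))).trans (hμQ n).le

theorem regular_of_absolutelyContinuous {ρ μ : Measure X} [IsFiniteMeasure ρ] [IsFiniteMeasure μ]
    [μ.Regular] (h : ρ ≪ μ) : ρ.Regular := by
  have : ρ.InnerRegularCompactLTTop := ⟨by
    rintro A ⟨hA, -⟩ r hr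
    obtain ⟨F, hFA, hF, hμF⟩ :=
      exists_isSigmaCompact_subset_measure_sdiff_eq_zero μ hA (measure_ne_top μ A)
    rw [← measure_eq_measure_of_null_sdiff hFA (h hμF)] at hr
    obtain ⟨Q, hQF, hQ, hrQ⟩ := exists_isCompact_lt_measure_of_isSigmaCompact hF hr
    exact ⟨Q, hQF.trans hFA, hQ, hrQ⟩⟩
  infer_instance

theorem exists_countable_measure_iUnion_sdiff_biUnion_eq_zero (μ : Measure X) [IsFiniteMeasure μ]
    [μ.InnerRegularCompactLTTop] {ι : Type*} {O : ι → Set X} (hO : ∀ i, IsOpen (O i)) :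
    ∃ S : Set ι, S.Countable ∧ μ ((⋃ i, O i) \ ⋃ i ∈ S, O i) = 0 := by
  obtain ⟨F, hFO, hF, hμF⟩ := exists_isSigmaCompact_subset_measure_sdiff_eq_zero μ
    (isOpen_iUnion hO).measurableSet (measure_ne_top μ _)
  obtain ⟨S, hS, hFS⟩ := hF.isLindelof.elim_countable_subcover O hO hFO
  exact ⟨S, hS, measure_mono_null (sdiff_subset_sdiff_right hFS) hμF⟩

theorem ext_of_integral_eq_of_hasCompactSupport [LocallyCompactSpace X] {μ ν : Measure X}
    [μ.Regular] [ν.Regular]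
    (h : ∀ g : X → ℝ, Continuous g → HasCompactSupport g → ∫ x, g x ∂μ = ∫ x, g x ∂ν) : μ = ν :=
  Measure.ext_of_integral_eq_on_compactlySupported fun f => h f f.continuous f.hasCompactSupport

theorem exists_isCutoffSeq [LocallyCompactSpace X] (μ : Measure X) [IsFiniteMeasure μ]
    [μ.InnerRegularCompactLTTop] : ∃ χ, IsCutoffSeq μ χ := by
  obtain ⟨_, -, ⟨Q, hQ, rfl⟩, hμQ⟩ := exists_isSigmaCompact_subset_measure_sdiff_eq_zero μ
    MeasurableSet.univ (measure_ne_top μ univ)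
  choose χ hχ_one _ hχc hχ_mem using fun n => exists_continuous_one_zero_of_isCompact
    (isCompact_accumulate hQ n) isClosed_empty (disjoint_empty _)
  refine ⟨fun n => χ n, fun n => (χ n).continuous, hχc, hχ_mem, ?_⟩
  rw [← compl_eq_univ_sdiff] at hμQ
  filter_upwards [compl_mem_ae_iff.2 hμQ] with x hx
  obtain ⟨m, hm⟩ := mem_iUnion.1 (compl_compl (⋃ n, Q n) ▸ hx)
  refine tendsto_const_nhds.congr' ?_
  filter_upwards [eventually_ge_atTop m] with n hn
  exact (hχ_one n (mem_accumulate.2 ⟨m, hn, hm⟩)).symm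

theorem continuous_integral_of_bounded [LocallyCompactSpace Y] (ν : Measure Y) [IsFiniteMeasure ν]
    [ν.InnerRegularCompactLTTop] {P : Type*} [TopologicalSpace P] {G : P → Y → ℝ}
    (hG : Continuous G.uncurry) {M : ℝ} (hM : ∀ p y, ‖G p y‖ ≤ M) :
    Continuous fun p => ∫ y, G p y ∂ν := by
  obtain ⟨ξ, hξ⟩ := exists_isCutoffSeq ν
  exact (hξ.tendstoUniformly_integral_mul (fun p => hG.comp (Continuous.prodMk_right p))
    hM).continuous (.of_forall (hξ.continuous_integral_mul hG))

theorem integral_integral_swap_of_continuous_of_bounded [LocallyCompactSpace X]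
    [LocallyCompactSpace Y] (μ : Measure X) [IsFiniteMeasure μ] [μ.InnerRegularCompactLTTop]
    (ν : Measure Y) [IsFiniteMeasure ν] [ν.InnerRegularCompactLTTop] {G : X → Y → ℝ}
    (hG : Continuous G.uncurry) {M : ℝ} (hM : ∀ x y, ‖G x y‖ ≤ M) :
    ∫ x, ∫ y, G x y ∂ν ∂μ = ∫ y, ∫ x, G x y ∂μ ∂ν := by
  obtain ⟨χ, hχ⟩ := exists_isCutoffSeq μ
  obtain ⟨ξ, hξ⟩ := exists_isCutoffSeq ν
  refine tendsto_nhds_unique (hχ.tendsto_integral_integral_mul hξ hG hM) ?_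
  convert hξ.tendsto_integral_integral_mul hχ (G := fun y x => G x y) (hG.comp continuous_swap)
    (fun y x => hM x y) using 2 with n
  simp only [mul_left_comm (ξ n _)]
  refine integral_integral_swap_of_hasCompactSupport
    (((hχ.continuous n).comp continuous_fst).mul (((hξ.continuous n).comp continuous_snd).mul hG))
    (HasCompactSupport.intro ((hχ.hasCompactSupport n).isCompact.prod
      (hξ.hasCompactSupport n).isCompact) fun p hp => ?_)
  rcases not_and_or.1 (mem_prod.not.1 hp) with hp | hp <;>
    simp [Function.uncurry, image_eq_zero_of_notMem_tsupport hp]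

end RegularMeasure

/-- A kernel of uniformly bounded regular measures that is continuous for the vague topology. -/
structure IsFellerKernel {X Y : Type*} [TopologicalSpace X] [TopologicalSpace Y]
    [MeasurableSpace Y] (κ : X → Measure Y) : Prop where
  regular : ∀ x, (κ x).Regular
  bound : ∃ M : ℝ≥0, ∀ x, κ x univ ≤ M
  continuous_integral : ∀ g : Y → ℝ, Continuous g → HasCompactSupport g →
    Continuous fun x => ∫ y, g y ∂κ x

namespace IsFellerKernel

section Basic

variable {X Y : Type*} [TopologicalSpace X] [TopologicalSpace Y] [MeasurableSpace Y]
  {κ : X → Measure Y}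

theorem comp (hκ : IsFellerKernel κ) {P : Type*} [TopologicalSpace P] {f : P → X}
    (hf : Continuous f) : IsFellerKernel fun p => κ (f p) where
  regular _ := hκ.regular _
  bound := ⟨hκ.bound.choose, fun _ => hκ.bound.choose_spec _⟩
  continuous_integral g hg hgc := (hκ.continuous_integral g hg hgc).comp hf

theorem isFiniteMeasure (hκ : IsFellerKernel κ) (x : X) : IsFiniteMeasure (κ x) :=
  ⟨(hκ.bound.choose_spec x).trans_lt ENNReal.coe_lt_top⟩

theorem exists_norm_integral_le (hκ : IsFellerKernel κ) {g : Y → ℝ} (hg : Continuous g)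
    (hgc : HasCompactSupport g) : ∃ C, ∀ x, ‖∫ y, g y ∂κ x‖ ≤ C := by
  obtain ⟨M, hM⟩ := hκ.bound
  have := hκ.isFiniteMeasure
  obtain ⟨C, hC⟩ := hgc.exists_bound_of_continuous hg
  refine ⟨|C| * M, fun x => (norm_integral_le_of_norm_le_const (C := |C|)
    (.of_forall fun y => (hC y).trans (le_abs_self C))).trans ?_⟩
  exact mul_le_mul_of_nonneg_left (ENNReal.toReal_le_coe_of_le_coe (hM x)) (abs_nonneg C)

variable [T2Space Y] [LocallyCompactSpace Y] [BorelSpace Y]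

theorem lowerSemicontinuous_measure (hκ : IsFellerKernel κ) {U : Set Y} (hU : IsOpen U) :
    LowerSemicontinuous fun x => κ x U := by
  intro x r hr
  have := hκ.regular x
  have := hκ.isFiniteMeasure
  obtain ⟨Q, hQU, hQ, hrQ⟩ := hU.exists_lt_isCompact hr
  obtain ⟨g, hg1, hg0, hgc, hg01⟩ := exists_continuous_one_zero_of_isCompact hQ hU.isClosed_compl
    (disjoint_compl_right_iff_subset.2 hQU)
  have hg : ∀ z, Integrable g (κ z) := fun z =>
    have := hκ.regular z
    g.continuous.integrable_of_hasCompactSupport hgc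
  have hQg : (κ x).real Q ≤ ∫ y, g y ∂κ x := by
    rw [← integral_indicator_one hQ.measurableSet]
    refine integral_mono ((integrable_const (1 : ℝ)).indicator hQ.measurableSet) (hg x)
      (indicator_le' (fun y hy => (hg1 hy).ge) fun y _ => (hg01 y).1)
  have hgU : ∀ z, ∫ y, g y ∂κ z ≤ (κ z).real U := fun z => by
    rw [← integral_indicator_one hU.measurableSet]
    refine integral_mono (hg z) ((integrable_const (1 : ℝ)).indicator hU.measurableSet)
      (le_indicator (fun y _ => (hg01 y).2) fun y hy => (hg0 hy).le)
  have hrg : r.toReal < ∫ y, g y ∂κ x :=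
    ((ENNReal.toReal_lt_toReal hrQ.ne_top (measure_ne_top _ _)).2 hrQ).trans_le hQg
  filter_upwards [(hκ.continuous_integral g g.continuous hgc).continuousAt.eventually_const_lt hrg]
    with z hz
  exact (ENNReal.toReal_lt_toReal hrQ.ne_top (measure_ne_top _ _)).1 (hz.trans_le (hgU z))

end Basic

section Bind

variable {X Y : Type*} [TopologicalSpace X] [MeasurableSpace X] [OpensMeasurableSpace X]
  [TopologicalSpace Y] [T2Space Y] [LocallyCompactSpace Y] [MeasurableSpace Y] [BorelSpace Y]
  {κ : X → Measure Y}

theorem measurable (hκ : IsFellerKernel κ) : Measurable κ := by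
  have := hκ.isFiniteMeasure
  exact Measurable.measure_of_isPiSystem (S := {U : Set Y | IsOpen U})
    (BorelSpace.measurable_eq (α := Y)) isPiSystem_isOpen
    (fun U hU => (hκ.lowerSemicontinuous_measure hU).measurable)
    (hκ.lowerSemicontinuous_measure isOpen_univ).measurable

theorem bind_apply (hκ : IsFellerKernel κ) (μ : Measure X) {s : Set Y} (hs : MeasurableSet s) :
    μ.bind κ s = ∫⁻ x, κ x s ∂μ :=
  Measure.bind_apply hs hκ.measurable.aemeasurable

theorem isFiniteMeasure_bind (hκ : IsFellerKernel κ) (μ : Measure X) [IsFiniteMeasure μ] :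
    IsFiniteMeasure (μ.bind κ) := by
  obtain ⟨M, hM⟩ := hκ.bound
  refine ⟨?_⟩
  rw [hκ.bind_apply μ .univ]
  calc ∫⁻ x, κ x univ ∂μ ≤ ∫⁻ _, (M : ℝ≥0∞) ∂μ := lintegral_mono hM
    _ < ∞ := by
      rw [lintegral_const]
      exact ENNReal.mul_lt_top ENNReal.coe_lt_top (measure_lt_top _ _)

theorem integral_bind (hκ : IsFellerKernel κ) (μ : Measure X)
    {E : Type*} [NormedAddCommGroup E] [NormedSpace ℝ E] {f : Y → E}
    (hf : Integrable f (μ.bind κ)) :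
    ∫ y, f y ∂μ.bind κ = ∫ x, ∫ y, f y ∂κ x ∂μ := by
  let k : ProbabilityTheory.Kernel X Y := ⟨κ, hκ.measurable⟩
  have : ProbabilityTheory.IsFiniteKernel k := by
    obtain ⟨M, hM⟩ := hκ.bound
    exact ⟨⟨M, ENNReal.coe_lt_top, hM⟩⟩
  have h : μ.bind κ = k.comp (ProbabilityTheory.Kernel.const Unit μ) () := by
    rw [ProbabilityTheory.Kernel.comp_apply, ProbabilityTheory.Kernel.const_apply]
    rfl
  rw [h] at hf ⊢
  rw [ProbabilityTheory.Kernel.integral_comp hf, ProbabilityTheory.Kernel.const_apply]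
  rfl

theorem integral_bind_of_bounded (hκ : IsFellerKernel κ) (μ : Measure X) [IsFiniteMeasure μ]
    {E : Type*} [NormedAddCommGroup E] [NormedSpace ℝ E] {f : Y → E}
    (hf : StronglyMeasurable f) {C : ℝ} (hC : ∀ y, ‖f y‖ ≤ C) :
    ∫ y, f y ∂μ.bind κ = ∫ x, ∫ y, f y ∂κ x ∂μ :=
  have := hκ.isFiniteMeasure_bind μ
  hκ.integral_bind μ (Integrable.of_bound hf.aestronglyMeasurable C (.of_forall hC))

theorem integral_bind_of_hasCompactSupport (hκ : IsFellerKernel κ) (μ : Measure X)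
    [IsFiniteMeasure μ] {g : Y → ℝ} (hg : Continuous g) (hgc : HasCompactSupport g) :
    ∫ y, g y ∂μ.bind κ = ∫ x, ∫ y, g y ∂κ x ∂μ :=
  have ⟨_, hC⟩ := hgc.exists_bound_of_continuous hg
  hκ.integral_bind_of_bounded μ (hg.stronglyMeasurable_of_hasCompactSupport hgc) hC

theorem measure_bind_pos_iff (hκ : IsFellerKernel κ) (μ : Measure X) [μ.Regular] {U : Set Y}
    (hU : IsOpen U) : 0 < μ.bind κ U ↔ ∃ x ∈ μ.support, 0 < κ x U := by
  rw [hκ.bind_apply μ hU.measurableSet,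
    lintegral_pos_iff_support ((hκ.lowerSemicontinuous_measure hU).measurable)]
  constructor
  · intro h
    by_contra! hcon
    refine h.ne' (measure_mono_null (t := μ.supportᶜ) (fun x hx hxs => ?_)
      Measure.measure_compl_support_of_regular)
    exact hx (le_antisymm (hcon x hxs) (zero_le))
  · rintro ⟨x, hx, hxU⟩
    refine (Measure.mem_support_iff_forall x).1 hx _ ?_
    filter_upwards [hκ.lowerSemicontinuous_measure hU x 0 hxU] with z hz using hz.ne'

end Bind

section Regular

variable {X Y : Type*} [TopologicalSpace X] [T2Space X] [MeasurableSpace X] [BorelSpace X]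
  [TopologicalSpace Y] [T2Space Y] [MeasurableSpace Y] [BorelSpace Y] [LocallyCompactSpace Y]
  {κ : X → Measure Y}

/- Every value `κ x U` is approximated from inside by relatively compact open sets `V`, and the sets
`{x | q < κ x V}` are open, so countably many `V` suffice for almost all `x` at once. -/
theorem exists_isSigmaCompact_ae_measure_sdiff_eq_zero (hκ : IsFellerKernel κ) (μ : Measure X)
    [IsFiniteMeasure μ] [μ.InnerRegularCompactLTTop] {U : Set Y} (hU : IsOpen U) :
    ∃ F ⊆ U, IsSigmaCompact F ∧ ∀ᵐ x ∂μ, κ x (U \ F) = 0 := by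
  let ι := {V : Set Y // IsOpen V ∧ closure V ⊆ U ∧ IsCompact (closure V)}
  choose S hS hμS using fun q : ℚ =>
    exists_countable_measure_iUnion_sdiff_biUnion_eq_zero μ (ι := ι)
      (O := fun V => {x | ((q : ℝ).toNNReal : ℝ≥0∞) < κ x V.1})
      fun V => (hκ.lowerSemicontinuous_measure V.2.1).isOpen_preimage _
  have hF : IsSigmaCompact (⋃ V ∈ ⋃ q, S q, closure V.1) :=
    isSigmaCompact_biUnion (countable_iUnion hS) fun V _ => V.2.2.2.isSigmaCompact
  refine ⟨_, iUnion₂_subset fun V _ => V.2.2.1, hF, ?_⟩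
  filter_upwards [ae_all_iff.2 fun q => measure_eq_zero_iff_ae_notMem.1 (hμS q)] with x hx
  have := hκ.regular x
  have := hκ.isFiniteMeasure x
  have hFm : MeasurableSet (⋃ V ∈ ⋃ q, S q, closure V.1) :=
    .biUnion (countable_iUnion hS) fun V _ => isClosed_closure.measurableSet
  rw [measure_sdiff (iUnion₂_subset fun V _ => V.2.2.1) hFm.nullMeasurableSet
    (measure_ne_top _ _), tsub_eq_zero_iff_le]
  refine le_of_forall_lt fun r hr => ?_
  obtain ⟨q, -, hrq, hqU⟩ := ENNReal.lt_iff_exists_rat_btwn.1 hr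
  obtain ⟨Q, hQU, hQ, hqQ⟩ := hU.exists_lt_isCompact hqU
  obtain ⟨W, hW, hQW, hWU, hWc⟩ := exists_open_between_and_isCompact_closure hQ hU hQU
  have hqW : x ∈ ⋃ V : ι, {x | ((q : ℝ).toNNReal : ℝ≥0∞) < κ x V.1} :=
    mem_iUnion.2 ⟨⟨W, hW, hWU, hWc⟩, hqQ.trans_le (measure_mono hQW)⟩
  obtain ⟨V, hVS, hqV⟩ := mem_iUnion₂.1 (not_not.1 fun h => hx q ⟨hqW, h⟩)
  exact hrq.trans (hqV.trans_le (measure_mono (subset_closure.trans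
    (subset_biUnion_of_mem (u := fun V : ι => closure V.1) (mem_iUnion.2 ⟨q, hVS⟩)))))

theorem regular_bind (hκ : IsFellerKernel κ) (μ : Measure X) [IsFiniteMeasure μ]
    [μ.InnerRegularCompactLTTop] : (μ.bind κ).Regular := by
  have := hκ.isFiniteMeasure_bind μ
  have hreg : Measure.InnerRegularWRT (μ.bind κ) IsCompact IsOpen := by
    intro U hU r hr
    obtain ⟨F, hFU, hF, hμF⟩ := hκ.exists_isSigmaCompact_ae_measure_sdiff_eq_zero μ hU
    have hFm : MeasurableSet F := by
      obtain ⟨Q, hQ, rfl⟩ := hF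
      exact .iUnion fun n => (hQ n).measurableSet
    have hnull : μ.bind κ (U \ F) = 0 := by
      rw [hκ.bind_apply μ (hU.measurableSet.diff hFm), lintegral_congr_ae hμF, lintegral_zero]
    rw [← measure_eq_measure_of_null_sdiff hFU hnull] at hr
    obtain ⟨Q, hQF, hQ, hrQ⟩ := exists_isCompact_lt_measure_of_isSigmaCompact hF hr
    exact ⟨Q, hQF.trans hFU, hQ, hrQ⟩
  have := Measure.InnerRegularWRT.weaklyRegular_of_finite (μ.bind κ) fun U hU r hr =>
    have ⟨Q, hQU, hQ, hrQ⟩ := hreg hU r hr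
    ⟨Q, hQU, hQ.isClosed, hrQ⟩
  exact { innerRegular := hreg }

end Regular

section Joint

variable {X Y Z : Type*} [TopologicalSpace X] [TopologicalSpace Y] [TopologicalSpace Z]
  [MeasurableSpace Z] {κ : X → Y → Measure Z}

theorem left (hκ : IsFellerKernel (Function.uncurry κ)) (y : Y) :
    IsFellerKernel fun x => κ x y :=
  hκ.comp (Continuous.prodMk_left y)

theorem right (hκ : IsFellerKernel (Function.uncurry κ)) (x : X) :
    IsFellerKernel (κ x) :=
  hκ.comp (Continuous.prodMk_right x)

variable [T2Space Y] [LocallyCompactSpace Y] [MeasurableSpace Y] [BorelSpace Y]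
  [T2Space Z] [LocallyCompactSpace Z] [BorelSpace Z]

theorem bind (hκ : IsFellerKernel (Function.uncurry κ)) (ν : Measure Y) [IsFiniteMeasure ν]
    [ν.InnerRegularCompactLTTop] : IsFellerKernel fun x => ν.bind (κ x) where
  regular x := (hκ.right x).regular_bind ν
  bound := by
    obtain ⟨M, hM⟩ := hκ.bound
    refine ⟨M * (ν univ).toNNReal, fun x => ?_⟩
    rw [(hκ.right x).bind_apply ν .univ, ENNReal.coe_mul, ENNReal.coe_toNNReal (measure_ne_top _ _),
      ← lintegral_const]
    exact lintegral_mono fun y => hM (x, y)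
  continuous_integral g hg hgc := by
    obtain ⟨B, hB⟩ := hκ.exists_norm_integral_le hg hgc
    simp only [fun x => (hκ.right x).integral_bind_of_hasCompactSupport ν hg hgc]
    exact continuous_integral_of_bounded ν (hκ.continuous_integral g hg hgc) fun x y => hB (x, y)

theorem bind_bind_comm [T2Space X] [LocallyCompactSpace X] [MeasurableSpace X] [BorelSpace X]
    (hκ : IsFellerKernel (Function.uncurry κ))
    (μ : Measure X) [IsFiniteMeasure μ] [μ.InnerRegularCompactLTTop] (ν : Measure Y)
    [IsFiniteMeasure ν] [ν.InnerRegularCompactLTTop] :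
    μ.bind (fun x => ν.bind (κ x)) = ν.bind (fun y => μ.bind fun x => κ x y) := by
  have hleft := hκ.bind ν
  have hright := IsFellerKernel.bind (κ := fun y x => κ x y) (hκ.comp continuous_swap) μ
  have := hleft.regular_bind μ
  have := hright.regular_bind ν
  refine ext_of_integral_eq_of_hasCompactSupport fun g hg hgc => ?_
  obtain ⟨B, hB⟩ := hκ.exists_norm_integral_le hg hgc
  rw [hleft.integral_bind_of_hasCompactSupport μ hg hgc,
    hright.integral_bind_of_hasCompactSupport ν hg hgc]
  simp only [fun x => (hκ.right x).integral_bind_of_hasCompactSupport ν hg hgc,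
    fun y => (hκ.left y).integral_bind_of_hasCompactSupport μ hg hgc]
  exact integral_integral_swap_of_continuous_of_bounded μ ν
    (hκ.continuous_integral g hg hgc) fun x y => hB (x, y)

end Joint

end IsFellerKernel

theorem measure_pos_iff_support_inter_nonempty {X : Type*} [TopologicalSpace X]
    [MeasurableSpace X] {μ : Measure X} [μ.Regular] {U : Set X}
    (hU : IsOpen U) : 0 < μ U ↔ (μ.support ∩ U).Nonempty := by
  constructor
  · intro h
    by_contra hcon
    refine h.ne' (measure_mono_null (t := μ.supportᶜ) (fun x hx hxs => ?_)
      Measure.measure_compl_support_of_regular)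
    exact hcon ⟨x, hxs, hx⟩
  · rintro ⟨x, hx, hxU⟩
    exact (Measure.mem_support_iff_forall x).1 hx U (hU.mem_nhds hxU)

section Density

/-- Continuous, compactly supported and nonnegative functions: the densities and the test functions
of the smoothing argument. -/
structure IsCcNonneg {X : Type*} [TopologicalSpace X] (φ : X → ℝ) : Prop where
  continuous : Continuous φ
  hasCompactSupport : HasCompactSupport φ
  nonneg : ∀ x, 0 ≤ φ x

/-- The measure `φ · ω` with density `φ`; the negative part of `φ` is discarded. -/
noncomputable def withRealDensity {X : Type*} [MeasurableSpace X] (ω : Measure X) (φ : X → ℝ) :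
    Measure X :=
  ω.withDensity fun x => ENNReal.ofReal (φ x)

theorem integral_withRealDensity {X : Type*} [MeasurableSpace X] {ω : Measure X} {φ : X → ℝ}
    (hφ : Measurable φ) (hφ_nonneg : ∀ x, 0 ≤ φ x) {E : Type*} [NormedAddCommGroup E]
    [NormedSpace ℝ E] (f : X → E) :
    ∫ x, f x ∂withRealDensity ω φ = ∫ x, φ x • f x ∂ω := by
  rw [withRealDensity, integral_withDensity_eq_integral_toReal_smul
    hφ.ennreal_ofReal (.of_forall fun x => ENNReal.ofReal_lt_top)]
  simp only [ENNReal.toReal_ofReal (hφ_nonneg _)]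

namespace IsCcNonneg

variable {X : Type*} [TopologicalSpace X] [MeasurableSpace X] {ω : Measure X} {φ : X → ℝ}

theorem isFiniteMeasure [OpensMeasurableSpace X] [IsFiniteMeasureOnCompacts ω]
    (hφ : IsCcNonneg φ) : IsFiniteMeasure (withRealDensity ω φ) :=
  isFiniteMeasure_withDensity_ofReal
    (hφ.continuous.integrable_of_hasCompactSupport hφ.hasCompactSupport).2

theorem regular [T2Space X] [BorelSpace X] [ω.Regular] (hφ : IsCcNonneg φ) :
    (withRealDensity ω φ).Regular := by
  have hsupp := hφ.hasCompactSupport.isCompact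
  have := hφ.isFiniteMeasure (ω := ω)
  have : IsFiniteMeasure (ω.restrict (tsupport φ)) := ⟨by
    simpa using hsupp.measure_lt_top⟩
  have := Measure.Regular.restrict_of_measure_ne_top (μ := ω) hsupp.measure_lt_top.ne
  refine regular_of_absolutelyContinuous (μ := ω.restrict (tsupport φ)) ?_
  have hrestrict : withRealDensity ω φ = withRealDensity (ω.restrict (tsupport φ)) φ := by
    rw [withRealDensity, withRealDensity, ← withDensity_indicator hsupp.measurableSet]
    congr 1
    refine (indicator_eq_self.2 fun x hx => subset_tsupport φ ?_).symm
    exact fun h => hx (by simp [h])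
  rw [hrestrict]
  exact withDensity_absolutelyContinuous _ _

end IsCcNonneg

end Density

theorem support_subset_closure_of_measure_compl_eq_zero {X : Type*} [TopologicalSpace X]
    [MeasurableSpace X] {μ : Measure X} {A : Set X} (hA : μ Aᶜ = 0) : μ.support ⊆ closure A :=
  Measure.support_subset_of_isClosed isClosed_closure
    (measure_mono_null (compl_subset_compl.2 subset_closure) hA)

theorem mem_support_map {X Y : Type*} [TopologicalSpace X] [MeasurableSpace X]
    [OpensMeasurableSpace X] [TopologicalSpace Y] [MeasurableSpace Y] [BorelSpace Y]
    {μ : Measure X} {f : X → Y} (hf : Continuous f) {x : X} (hx : x ∈ μ.support) :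
    f x ∈ (μ.map f).support := by
  rw [Measure.mem_support_iff_forall] at hx ⊢
  intro U hU
  exact (hx _ (hf.continuousAt.preimage_mem_nhds hU)).trans_le
    (Measure.le_map_apply hf.measurable.aemeasurable U)

namespace Hypergroup

section Support

variable {K : Type*} [TopologicalSpace K] [T2Space K] [LocallyCompactSpace K]
  [MeasurableSpace K] [BorelSpace K] [Hypergroup K]

instance (x y : K) : (conv x y : Measure K).Regular := regular_conv x y

theorem continuous_integral_conv {g : K → ℝ} (hg : Continuous g) {C : ℝ} (hC : ∀ x, ‖g x‖ ≤ C) :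
    Continuous fun p : K × K => ∫ t, g t ∂(conv p.1 p.2 : Measure K) :=
  (ProbabilityMeasure.continuous_integral_boundedContinuousFunction
    (BoundedContinuousFunction.ofNormedAddCommGroup g hg C hC)).comp continuous_conv

theorem isFellerKernel_conv :
    IsFellerKernel (Function.uncurry fun x y : K => (conv x y : Measure K)) where
  regular p := regular_conv p.1 p.2
  bound := ⟨1, fun p => by simp [Function.uncurry]⟩
  continuous_integral g hg hgc := by
    obtain ⟨C, hC⟩ := hgc.exists_bound_of_continuous hg
    exact continuous_integral_conv hg hC

theorem isFellerKernel_conv_left (y : K) : IsFellerKernel fun x : K => (conv x y : Measure K) :=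
  isFellerKernel_conv.left y

theorem isFellerKernel_conv_right (x : K) : IsFellerKernel fun y : K => (conv x y : Measure K) :=
  isFellerKernel_conv.right x

theorem bind_conv_assoc (x y z : K) :
    (conv x y : Measure K).bind (fun t => (conv t z : Measure K)) =
      (conv y z : Measure K).bind (fun t => (conv x t : Measure K)) := by
  have hleft := isFellerKernel_conv_left z
  have hright := isFellerKernel_conv_right x
  have := hleft.regular_bind (conv x y : Measure K)
  have := hright.regular_bind (conv y z : Measure K)
  refine ext_of_integral_eq_of_hasCompactSupport fun g hg hgc => ?_
  obtain ⟨C, hC⟩ := hgc.exists_bound_of_continuous hg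
  rw [hleft.integral_bind_of_hasCompactSupport _ hg hgc,
    hright.integral_bind_of_hasCompactSupport _ hg hgc]
  have h := conv_assoc x y z (BoundedContinuousFunction.ofNormedAddCommGroup
    (fun x => (g x : ℂ)) (Complex.continuous_ofReal.comp hg) C fun x => by simpa using hC x)
  simp only [BoundedContinuousFunction.coe_ofNormedAddCommGroup, integral_complex_ofReal] at h
  exact_mod_cast h

theorem exists_continuous_support : ∃ S : K × K → NonemptyCompacts K, Continuous S ∧
    ∀ p : K × K, (S p : Set K) = (conv p.1 p.2 : Measure K).support :=
  let ⟨S, hS, h⟩ := continuous_supp (K := K)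
  ⟨S, hS, fun p => h p.1 p.2⟩

theorem isCompact_support (x y : K) : IsCompact (conv x y : Measure K).support := by
  obtain ⟨S, -, hS⟩ := exists_continuous_support (K := K)
  rw [← hS (x, y)]
  exact (S (x, y)).isCompact

theorem support_nonempty (x y : K) : (conv x y : Measure K).support.Nonempty := by
  obtain ⟨S, -, hS⟩ := exists_continuous_support (K := K)
  rw [← hS (x, y)]
  exact (S (x, y)).nonempty

theorem isOpen_support_inter_nonempty {U : Set K} (hU : IsOpen U) :
    IsOpen {p : K × K | ((conv p.1 p.2 : Measure K).support ∩ U).Nonempty} := by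
  obtain ⟨S, hSc, hS⟩ := exists_continuous_support (K := K)
  simp_rw [← hS]
  exact (NonemptyCompacts.isOpen_inter_nonempty_of_isOpen hU).preimage hSc

theorem isOpen_support_subset {U : Set K} (hU : IsOpen U) :
    IsOpen {p : K × K | (conv p.1 p.2 : Measure K).support ⊆ U} := by
  obtain ⟨S, hSc, hS⟩ := exists_continuous_support (K := K)
  simp_rw [← hS]
  exact (NonemptyCompacts.isOpen_subsets_of_isOpen hU).preimage hSc

theorem mem_setMul {A B : Set K} {t : K} :
    t ∈ setMul A B ↔ ∃ a ∈ A, ∃ b ∈ B, t ∈ (conv a b : Measure K).support := by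
  simp [setMul]

theorem isCompact_setMul {A B : Set K} (hA : IsCompact A) (hB : IsCompact B) :
    IsCompact (setMul A B) := by
  obtain ⟨S, hSc, hS⟩ := exists_continuous_support (K := K)
  have h := Compacts.isCompact_biUnion_coe_of_isCompact
    (((hA.prod hB).image hSc).image NonemptyCompacts.continuous_toCompacts)
  convert h using 1
  ext t
  rw [mem_setMul, mem_iUnion₂]
  constructor
  · rintro ⟨a, ha, b, hb, ht⟩
    refine ⟨_, ⟨_, ⟨(a, b), ⟨ha, hb⟩, rfl⟩, rfl⟩, ?_⟩
    rw [NonemptyCompacts.coe_toCompacts, hS]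
    exact ht
  · rintro ⟨_, ⟨_, ⟨⟨a, b⟩, hab, rfl⟩, rfl⟩, ht⟩
    rw [NonemptyCompacts.coe_toCompacts, hS] at ht
    exact ⟨a, hab.1, b, hab.2, ht⟩

theorem inv_mem_support {x y t : K} (ht : t ∈ (conv x y : Measure K).support) :
    inv t ∈ (conv (inv y) (inv x) : Measure K).support := by
  rw [← map_inv_conv]
  exact mem_support_map continuous_inv ht

theorem mem_support_inv_left {x y t : K} (ht : t ∈ (conv x y : Measure K).support) :
    y ∈ (conv (inv x) t : Measure K).support := by
  suffices h : inv y ∈ (conv (inv t) x : Measure K).support by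
    simpa only [inv_inv] using inv_mem_support h
  by_contra hcon
  have hclosed : IsClosed (setMul (conv (inv t) x : Measure K).support {y}) :=
    (isCompact_setMul (isCompact_support _ _) isCompact_singleton).isClosed
  have he : e ∉ setMul (conv (inv t) x : Measure K).support {y} := by
    rw [mem_setMul]
    rintro ⟨s, hs, y', rfl, h⟩
    rw [e_mem_support_iff] at h
    exact hcon (h ▸ hs)
  have hpos : 0 < (conv x y : Measure K).bind (fun s => (conv (inv t) s : Measure K))
      (setMul (conv (inv t) x : Measure K).support {y})ᶜ := by
    rw [(isFellerKernel_conv_right (inv t)).measure_bind_pos_iff _ hclosed.isOpen_compl]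
    refine ⟨t, ht, ?_⟩
    rw [measure_pos_iff_support_inter_nonempty hclosed.isOpen_compl]
    exact ⟨e, (e_mem_support_iff _ _).2 rfl, he⟩
  rw [← bind_conv_assoc, (isFellerKernel_conv_left y).measure_bind_pos_iff _
    hclosed.isOpen_compl] at hpos
  obtain ⟨s, hs, hsU⟩ := hpos
  rw [measure_pos_iff_support_inter_nonempty hclosed.isOpen_compl] at hsU
  obtain ⟨r, hr, hrU⟩ := hsU
  exact hrU (mem_setMul.2 ⟨s, hs, y, rfl, hr⟩)

theorem mem_support_inv_right {x y t : K} (ht : t ∈ (conv x y : Measure K).support) :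
    x ∈ (conv t (inv y) : Measure K).support := by
  simpa only [inv_inv] using inv_mem_support (mem_support_inv_left (inv_mem_support ht))

theorem e_mem_support_inv_left (x : K) : e ∈ (conv (inv x) x : Measure K).support :=
  (e_mem_support_iff _ _).2 rfl

theorem e_mem_support_inv_right (x : K) : e ∈ (conv x (inv x) : Measure K).support :=
  (e_mem_support_iff _ _).2 (inv_inv x).symm

theorem inv_e : inv (e : K) = e := by
  have h := e_mem_support_inv_right (e : K)
  rw [e_conv] at h
  by_contra hne
  have := (Measure.mem_support_iff_forall _).1 h {inv e}ᶜ
    (isOpen_compl_singleton.mem_nhds fun h => hne h.symm)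
  simp at this

theorem setMul_mono {A A' B B' : Set K} (hA : A ⊆ A') (hB : B ⊆ B') :
    setMul A B ⊆ setMul A' B' := fun t ht => by
  obtain ⟨a, ha, b, hb, h⟩ := mem_setMul.1 ht
  exact mem_setMul.2 ⟨a, hA ha, b, hB hb, h⟩

theorem setMul_closure_subset (A B : Set K) :
    setMul (closure A) (closure B) ⊆ closure (setMul A B) := by
  intro t ht
  obtain ⟨a, ha, b, hb, h⟩ := mem_setMul.1 ht
  refine mem_closure_iff.2 fun U hU htU => ?_
  have hab : (a, b) ∈ closure (A ×ˢ B) := by rw [closure_prod_eq]; exact ⟨ha, hb⟩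
  obtain ⟨⟨a', b'⟩, ⟨s, hs, hsU⟩, ha', hb'⟩ :=
    mem_closure_iff.1 hab _ (isOpen_support_inter_nonempty hU) ⟨t, h, htU⟩
  exact ⟨s, hsU, mem_setMul.2 ⟨a', ha', b', hb', hs⟩⟩

theorem setPow_subset_closure {A B : Set K} (h : A ⊆ closure B) (n : ℕ) :
    setPow A n ⊆ closure (setPow B n) := by
  induction n with
  | zero => exact subset_closure
  | succ n ih => exact (setMul_mono ih h).trans (setMul_closure_subset _ _)

theorem isSigmaCompact_setMul {A B : Set K} (hA : IsSigmaCompact A) (hB : IsSigmaCompact B) :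
    IsSigmaCompact (setMul A B) := by
  obtain ⟨P, hP, rfl⟩ := hA
  obtain ⟨Q, hQ, rfl⟩ := hB
  have : setMul (⋃ i, P i) (⋃ j, Q j) = ⋃ p : ℕ × ℕ, setMul (P p.1) (Q p.2) := by
    ext t
    simp only [mem_setMul, mem_iUnion, Prod.exists]
    constructor
    · rintro ⟨a, ⟨i, ha⟩, b, ⟨j, hb⟩, h⟩
      exact ⟨i, j, a, ha, b, hb, h⟩
    · rintro ⟨i, j, a, ha, b, hb, h⟩
      exact ⟨a, ⟨i, ha⟩, b, ⟨j, hb⟩, h⟩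
  rw [this]
  exact isSigmaCompact_iUnion _ fun p => (isCompact_setMul (hP _) (hQ _)).isSigmaCompact

theorem isSigmaCompact_setPow {A : Set K} (hA : IsSigmaCompact A) (n : ℕ) :
    IsSigmaCompact (setPow A n) := by
  induction n with
  | zero => exact isCompact_singleton.isSigmaCompact
  | succ n ih => exact isSigmaCompact_setMul ih hA

theorem setMul_eq_univ_of_dense {D V : Set K} (hD : Dense D) (hV : V ∈ 𝓝 (e : K)) :
    setMul D V = univ := by
  refine eq_univ_of_forall fun x => ?_
  have hopen : IsOpen {t : K | ((conv (inv t) x : Measure K).support ∩ interior V).Nonempty} :=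
    (isOpen_support_inter_nonempty isOpen_interior).preimage
      (f := fun t : K => (inv t, x)) (continuous_inv.prodMk continuous_const)
  obtain ⟨t, ⟨v, hv, hvV⟩, htD⟩ := hD.inter_open_nonempty _ hopen
    ⟨x, e, e_mem_support_inv_left x, mem_interior_iff_mem_nhds.2 hV⟩
  refine mem_setMul.2 ⟨t, htD, v, interior_subset hvV, ?_⟩
  simpa only [inv_inv] using mem_support_inv_left hv

theorem IsNondegenerate.dense_iUnion_setPow {σ : Measure K} (hσ : IsNondegenerate σ) {A : Set K}
    (hA : σ Aᶜ = 0) : Dense (⋃ n, setPow A n) := by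
  rw [dense_iff_closure_eq, ← univ_subset_iff, ← hσ]
  refine closure_minimal (iUnion₂_subset fun n _ => ?_) isClosed_closure
  exact (setPow_subset_closure (support_subset_closure_of_measure_compl_eq_zero hA) n).trans
    (closure_mono (subset_iUnion (setPow A) n))

theorem IsNondegenerate.sigmaCompactSpace {σ : Measure K} [IsFiniteMeasure σ] [σ.Regular]
    (hσ : IsNondegenerate σ) : SigmaCompactSpace K := by
  obtain ⟨A, -, hA, hσA⟩ := exists_isSigmaCompact_subset_measure_sdiff_eq_zero σ .univ
    (measure_ne_top σ univ)
  rw [← compl_eq_univ_sdiff] at hσA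
  obtain ⟨V, hV, hVe⟩ := exists_compact_mem_nhds (e : K)
  rw [← isSigmaCompact_univ_iff, ← setMul_eq_univ_of_dense (hσ.dense_iUnion_setPow hσA) hVe]
  exact isSigmaCompact_setMul (isSigmaCompact_iUnion _ fun n => isSigmaCompact_setPow hA n)
    hV.isSigmaCompact

end Support

end Hypergroup

theorem integral_pos_of_mem_support {X : Type*} [TopologicalSpace X] [MeasurableSpace X]
    {μ : Measure X} {k : X → ℝ} (hk : Continuous k) (hk0 : ∀ x, 0 ≤ k x) (hi : Integrable k μ)
    {x : X} (hx : x ∈ μ.support) (hkx : 0 < k x) : 0 < ∫ y, k y ∂μ := by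
  rw [integral_pos_iff_support_of_nonneg hk0 hi]
  refine (Measure.mem_support_iff_forall x).1 hx _ ?_
  filter_upwards [hk.continuousAt.eventually_const_lt hkx] with y hy using hy.ne'

theorem tendsto_integral_smul_of_tendstoUniformly {ι X : Type*} [MeasurableSpace X]
    {μ : Measure X} {E : Type*} [NormedAddCommGroup E] [NormedSpace ℝ E] {l : Filter ι}
    {F : ι → X → ℝ} {G : X → ℝ} {u : X → E} (h : TendstoUniformly F G l) (hu : Integrable u μ)
    (hF : ∀ᶠ i in l, Integrable (fun x => F i x • u x) μ)
    (hG : Integrable (fun x => G x • u x) μ) :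
    Tendsto (fun i => ∫ x, F i x • u x ∂μ) l (𝓝 (∫ x, G x • u x ∂μ)) := by
  rw [Metric.tendsto_nhds]
  intro ε hε
  have hc : 0 < ∫ x, ‖u x‖ ∂μ + 1 :=
    add_pos_of_nonneg_of_pos (integral_nonneg fun _ => norm_nonneg _) one_pos
  filter_upwards [hF, Metric.tendstoUniformly_iff.1 h (ε / (∫ x, ‖u x‖ ∂μ + 1)) (div_pos hε hc)]
    with i hFi hi
  rw [dist_eq_norm, ← integral_sub hFi hG]
  calc ‖∫ x, F i x • u x - G x • u x ∂μ‖
      ≤ ∫ x, ε / (∫ x, ‖u x‖ ∂μ + 1) * ‖u x‖ ∂μ := by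
        refine norm_integral_le_of_norm_le (hu.norm.const_mul _) (.of_forall fun x => ?_)
        rw [← sub_smul, norm_smul, ← dist_eq_norm, dist_comm]
        exact mul_le_mul_of_nonneg_right (hi x).le (norm_nonneg _)
    _ = ε / (∫ x, ‖u x‖ ∂μ + 1) * ∫ x, ‖u x‖ ∂μ := integral_const_mul _ _
    _ < ε / (∫ x, ‖u x‖ ∂μ + 1) * (∫ x, ‖u x‖ ∂μ + 1) :=
        mul_lt_mul_of_pos_left (lt_add_one _) (div_pos hε hc)
    _ = ε := div_mul_cancel₀ _ hc.ne'

namespace Hypergroup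

section Translation

variable {K : Type*} [TopologicalSpace K] [T2Space K] [LocallyCompactSpace K]
  [MeasurableSpace K] [BorelSpace K] [Hypergroup K]

/-- `k(x * y) = ∫ k d(δ_x * δ_y)` for real functions. -/
noncomputable def realTrans (k : K → ℝ) (x y : K) : ℝ := ∫ t, k t ∂(conv x y : Measure K)

theorem realTrans_nonneg {k : K → ℝ} (hk0 : ∀ x, 0 ≤ k x) (x y : K) : 0 ≤ realTrans k x y :=
  integral_nonneg hk0

theorem realTrans_e (k : K → ℝ) : realTrans k e = k := by
  ext x
  rw [realTrans, e_conv, integral_dirac]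

theorem continuous_realTrans {k : K → ℝ} (hk : Continuous k) (hkc : HasCompactSupport k) :
    Continuous fun p : K × K => realTrans k p.1 p.2 := by
  obtain ⟨C, hC⟩ := hkc.exists_bound_of_continuous hk
  exact continuous_integral_conv hk hC

theorem continuous_realTrans_right {k : K → ℝ} (hk : Continuous k) (hkc : HasCompactSupport k)
    (x : K) : Continuous (realTrans k x) :=
  (continuous_realTrans hk hkc).comp (Continuous.prodMk_right x)

theorem exists_mem_support_of_realTrans_ne_zero {k : K → ℝ} {x y : K}
    (h : realTrans k x y ≠ 0) : ∃ t ∈ (conv x y : Measure K).support, k t ≠ 0 := by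
  by_contra! hcon
  refine h (integral_eq_zero_of_ae ?_)
  filter_upwards [Measure.support_mem_ae_of_regular (μ := (conv x y : Measure K))] with t ht
    using hcon t ht

theorem mem_setMul_of_realTrans_ne_zero {k : K → ℝ} {x y : K} {Q : Set K} (hx : inv x ∈ Q)
    (h : realTrans k x y ≠ 0) : y ∈ setMul Q (Function.support k) := by
  obtain ⟨t, ht, hkt⟩ := exists_mem_support_of_realTrans_ne_zero h
  exact mem_setMul.2 ⟨inv x, hx, t, hkt, mem_support_inv_left ht⟩

theorem hasCompactSupport_realTrans {k : K → ℝ} (hkc : HasCompactSupport k) (x : K) :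
    HasCompactSupport (realTrans k x) := by
  refine HasCompactSupport.intro (isCompact_setMul (isCompact_singleton (x := inv x)) hkc)
    fun y hy => ?_
  by_contra h
  exact hy (setMul_mono Subset.rfl (subset_tsupport k) (mem_setMul_of_realTrans_ne_zero rfl h))

theorem _root_.IsCcNonneg.realTrans {φ : K → ℝ} (hφ : IsCcNonneg φ) (x : K) :
    IsCcNonneg (realTrans φ x) where
  continuous := continuous_realTrans_right hφ.continuous hφ.hasCompactSupport x
  hasCompactSupport := hasCompactSupport_realTrans hφ.hasCompactSupport x
  nonneg := realTrans_nonneg hφ.nonneg x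

theorem realTrans_inv_comm {k : K → ℝ} (hk : Continuous k) (hks : ∀ x, k (inv x) = k x)
    (s t : K) : realTrans k (inv s) t = realTrans k (inv t) s := by
  have h := map_inv_conv (inv t) s
  rw [inv_inv] at h
  rw [realTrans, ← h, integral_map continuous_inv.measurable.aemeasurable
    hk.measurable.aestronglyMeasurable]
  simp only [hks]
  rfl

theorem integral_comp_inv_conv {g : K → ℝ} (hg : Continuous g) (x s : K) :
    ∫ u, g (inv u) ∂(conv (inv s) x : Measure K) = realTrans g (inv x) s := by
  have h := map_inv_conv (inv s) x
  rw [inv_inv] at h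
  rw [realTrans, ← h, integral_map continuous_inv.measurable.aemeasurable
    hg.measurable.aestronglyMeasurable]

theorem tendstoUniformly_realTrans {ι : Type*} {l : Filter ι} {F : ι → K → ℝ} {G : K → ℝ}
    (h : TendstoUniformly F G l) (hF : ∀ᶠ i in l, Continuous (F i) ∧ HasCompactSupport (F i))
    (hG : Continuous G) (hGc : HasCompactSupport G) (x : K) :
    TendstoUniformly (fun i => realTrans (F i) x) (realTrans G x) l := by
  rw [Metric.tendstoUniformly_iff] at h ⊢
  intro ε hε
  filter_upwards [hF, h (ε / 2) (half_pos hε)] with i ⟨hFi, hFic⟩ hi y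
  rw [dist_eq_norm, realTrans, realTrans, ← integral_sub
    (hG.integrable_of_hasCompactSupport hGc) (hFi.integrable_of_hasCompactSupport hFic)]
  refine (norm_integral_le_of_norm_le_const (C := ε / 2) (.of_forall fun t => ?_)).trans_lt ?_
  · rw [← dist_eq_norm]
    exact (hi t).le
  · simpa using half_lt_self hε

/-- The left translate `δ_x * ν` of a measure `ν`. -/
noncomputable def leftTranslate (ν : Measure K) (x : K) : Measure K :=
  ν.bind fun y => (conv x y : Measure K)

theorem leftTranslate_e (ν : Measure K) : leftTranslate ν e = ν := by
  simp_rw [leftTranslate, e_conv]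
  exact Measure.bind_dirac

section Finite

variable (ν : Measure K) [IsFiniteMeasure ν]

theorem integral_leftTranslate {E : Type*} [NormedAddCommGroup E] [NormedSpace ℝ E] {f : K → E}
    (hf : StronglyMeasurable f) {C : ℝ} (hC : ∀ y, ‖f y‖ ≤ C) (x : K) :
    ∫ t, f t ∂leftTranslate ν x = ∫ y, ∫ t, f t ∂(conv x y : Measure K) ∂ν :=
  (isFellerKernel_conv_right x).integral_bind_of_bounded ν hf hC

variable [ν.Regular]

theorem isFellerKernel_leftTranslate : IsFellerKernel (leftTranslate ν) :=
  isFellerKernel_conv.bind ν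

theorem leftTranslate_leftTranslate (x y : K) :
    leftTranslate (leftTranslate ν x) y = (conv y x : Measure K).bind (leftTranslate ν) := by
  rw [leftTranslate, leftTranslate,
    Measure.bind_bind (isFellerKernel_conv_right x).measurable.aemeasurable
      (isFellerKernel_conv_right y).measurable.aemeasurable]
  simp_rw [← bind_conv_assoc]
  exact (isFellerKernel_conv.bind_bind_comm (conv y x : Measure K) ν).symm

end Finite

variable {ω : Measure K}

theorem IsLeftHaar.integral_realTrans (hω : IsLeftHaar ω) {k : K → ℝ} (hk : Continuous k)
    (hkc : HasCompactSupport k) (x : K) : ∫ y, realTrans k x y ∂ω = ∫ y, k y ∂ω := by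
  have h := hω.left_inv x (fun y => (k y : ℂ)) (Complex.continuous_ofReal.comp hk)
    (hkc.comp_left Complex.ofReal_zero)
  simp only [trans, integral_complex_ofReal] at h
  exact_mod_cast h

theorem IsLeftHaar.nonempty_support (hω : IsLeftHaar ω) : ω.support.Nonempty := by
  have := hω.regular
  rw [nonempty_iff_ne_empty]
  intro h
  have hnull := Measure.measure_compl_support_of_regular (μ := ω)
  rw [h, compl_empty] at hnull
  exact hω.ne_zero (Measure.measure_univ_eq_zero.1 hnull)

theorem IsLeftHaar.isOpenPosMeasure (hω : IsLeftHaar ω) : ω.IsOpenPosMeasure := by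
  have := hω.regular
  refine ⟨fun U hU ⟨x, hx⟩ hU0 => ?_⟩
  obtain ⟨t₀, ht₀⟩ := hω.nonempty_support
  obtain ⟨z, hz⟩ := support_nonempty x (inv t₀)
  have hxz : x ∈ (conv z t₀ : Measure K).support := by
    simpa only [inv_inv] using mem_support_inv_right hz
  obtain ⟨k, hk1, hk0, hkc, hk01⟩ := exists_continuous_one_zero_of_isCompact
    (isCompact_singleton (x := x)) hU.isClosed_compl (by simpa using hx)
  have hkx : k x = 1 := hk1 rfl
  have hk : IsCcNonneg k := ⟨k.continuous, hkc, fun y => (hk01 y).1⟩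
  have hpos : 0 < realTrans k z t₀ :=
    integral_pos_of_mem_support hk.continuous hk.nonneg
      (hk.continuous.integrable_of_hasCompactSupport hkc) hxz (by rw [hkx]; exact one_pos)
  have hint : 0 < ∫ y, realTrans k z y ∂ω :=
    integral_pos_of_mem_support (hk.realTrans z).continuous (hk.realTrans z).nonneg
      ((hk.realTrans z).continuous.integrable_of_hasCompactSupport
        (hk.realTrans z).hasCompactSupport) ht₀ hpos
  rw [hω.integral_realTrans hk.continuous hkc] at hint
  refine hint.ne' (integral_eq_zero_of_ae ?_)
  filter_upwards [measure_eq_zero_iff_ae_notMem.1 hU0] with y hy using hk0 hy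

end Translation

section Smoothing

variable {K : Type*} [TopologicalSpace K] [T2Space K] [LocallyCompactSpace K]
  [MeasurableSpace K] [BorelSpace K] [Hypergroup K]
  {E : Type*} [NormedAddCommGroup E] [NormedSpace ℝ E] {ω : Measure K}

/-- The right convolution `f * φ`, written as `∫ φ(x̌ * s) f(s) dω(s)` so that it makes sense for a
merely locally integrable `f`. -/
noncomputable def smoothing (ω : Measure K) (φ : K → ℝ) (f : K → E) (x : K) : E :=
  ∫ s, realTrans φ (inv x) s • f s ∂ω

theorem smoothing_inv {φ : K → ℝ} (f : K → E) (x : K) :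
    smoothing ω φ f (inv x) = ∫ s, realTrans φ x s • f s ∂ω := by
  rw [smoothing, inv_inv]

theorem continuous_smoothing {φ : K → ℝ} (hφ : Continuous φ) (hφc : HasCompactSupport φ)
    {f : K → E} (hf : LocallyIntegrable f ω) : Continuous (smoothing ω φ f) := by
  rw [continuous_iff_continuousAt]
  intro x
  obtain ⟨Q, hQ, hQx⟩ := exists_compact_mem_nhds x
  have hk := isCompact_setMul hQ hφc
  refine ContinuousOn.continuousAt (s := Q) ?_ hQx
  refine continuousOn_integral_bilinear_of_locally_integrable_of_compact_support
    (ContinuousLinearMap.lsmul ℝ ℝ : ℝ →L[ℝ] E →L[ℝ] E).flip hk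
    (f := fun x s => realTrans φ (inv x) s) ?_ ?_ (hf.integrableOn_isCompact hk)
  · exact ((continuous_realTrans hφ hφc).comp
      ((continuous_inv.comp continuous_fst).prodMk continuous_snd)).continuousOn
  · intro u s hu hs
    by_contra hne
    exact hs (setMul_mono Subset.rfl (subset_tsupport φ)
      (mem_setMul_of_realTrans_ne_zero (by rwa [inv_inv]) hne))

/-- A symmetric continuous density of total mass one and compact support. -/
structure IsSymmetricMollifier (ω : Measure K) (k : K → ℝ) : Prop extends IsCcNonneg k where
  symm : ∀ x, k (inv x) = k x
  integral_eq_one : ∫ x, k x ∂ω = 1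

theorem support_smoothing_subset {k : K → ℝ} (hk : IsSymmetricMollifier ω k) (f : K → E) :
    Function.support (smoothing ω k f) ⊆ setMul (Function.support f) (Function.support k) := by
  intro x hx
  obtain ⟨s, hs⟩ : ∃ s, realTrans k (inv x) s • f s ≠ 0 := by
    by_contra! h
    exact hx (integral_eq_zero_of_ae (.of_forall h))
  rw [realTrans_inv_comm hk.continuous hk.symm] at hs
  exact mem_setMul_of_realTrans_ne_zero
    (by rw [inv_inv]; exact right_ne_zero_of_smul hs) (left_ne_zero_of_smul hs)

theorem hasCompactSupport_smoothing {k : K → ℝ} (hk : IsSymmetricMollifier ω k) {f : K → E}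
    (hf : HasCompactSupport f) : HasCompactSupport (smoothing ω k f) :=
  .of_support_subset_isCompact (isCompact_setMul hf hk.hasCompactSupport)
    ((support_smoothing_subset hk f).trans
      (setMul_mono (subset_tsupport f) (subset_tsupport k)))

theorem isCcNonneg_smoothing [ω.Regular] {k ψ : K → ℝ} (hk : IsSymmetricMollifier ω k)
    (hψ : IsCcNonneg ψ) : IsCcNonneg (smoothing ω k ψ) where
  continuous := continuous_smoothing hk.continuous hk.hasCompactSupport
    hψ.continuous.locallyIntegrable
  hasCompactSupport := hasCompactSupport_smoothing hk hψ.hasCompactSupport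
  nonneg _ := integral_nonneg fun s => mul_nonneg (realTrans_nonneg hk.nonneg _ _) (hψ.nonneg s)

theorem IsLeftHaar.exists_isSymmetricMollifier (hω : IsLeftHaar ω) {V : Set K}
    (hV : V ∈ 𝓝 (e : K)) : ∃ k, IsSymmetricMollifier ω k ∧ Function.support k ⊆ V := by
  have := hω.regular
  have := hω.isOpenPosMeasure
  obtain ⟨k, hk1, hk0, hkc, hk01⟩ := exists_continuous_one_zero_of_isCompact
    (isCompact_singleton (x := (e : K))) (isOpen_interior (s := V)).isClosed_compl
    (by simpa using mem_interior_iff_mem_nhds.2 hV)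
  have hke : k e = 1 := hk1 rfl
  have hc : Continuous fun x => k x * k (inv x) :=
    k.continuous.mul (k.continuous.comp continuous_inv)
  have hcc : HasCompactSupport fun x => k x * k (inv x) := hkc.mul_right
  have h0 : ∀ x, 0 ≤ k x * k (inv x) := fun x => mul_nonneg (hk01 _).1 (hk01 _).1
  have hpos : 0 < ∫ x, k x * k (inv x) ∂ω :=
    integral_pos_of_mem_support (x := e) hc h0 (hc.integrable_of_hasCompactSupport hcc)
      (by rw [Measure.support_eq_univ]; trivial) (by simp [inv_e, hke])
  refine ⟨fun x => k x * k (inv x) / ∫ x, k x * k (inv x) ∂ω, ?_, fun x hx => ?_⟩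
  · exact
      { continuous := hc.div_const _
        hasCompactSupport := hcc.mul_right
        nonneg := fun x => div_nonneg (h0 x) hpos.le
        symm := fun x => by simp only [inv_inv, mul_comm]
        integral_eq_one := by rw [integral_div, div_self hpos.ne'] }
  · by_contra hxV
    have hkx : k x = 0 := hk0 fun h => hxV (interior_subset h)
    exact hx (by simp [hkx])

/-- The filter along which symmetric mollifiers shrink to the identity. -/
def approxIdentity (ω : Measure K) : Filter (K → ℝ) :=
  (𝓝 (e : K)).smallSets.comap Function.support ⊓ 𝓟 {k | IsSymmetricMollifier ω k}

theorem IsLeftHaar.neBot_approxIdentity (hω : IsLeftHaar ω) : (approxIdentity ω).NeBot := by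
  refine inf_principal_neBot_iff.2 fun U hU => ?_
  obtain ⟨T, hT, hTU⟩ := hU
  obtain ⟨V, hV, hVT⟩ := eventually_smallSets.1 hT
  obtain ⟨k, hk, hkV⟩ := hω.exists_isSymmetricMollifier hV
  exact ⟨k, hTU (hVT _ hkV), hk⟩

theorem eventually_isSymmetricMollifier : ∀ᶠ k in approxIdentity ω, IsSymmetricMollifier ω k :=
  mem_inf_of_right (mem_principal_self _)

theorem eventually_support_subset {V : Set K} (hV : V ∈ 𝓝 (e : K)) :
    ∀ᶠ k in approxIdentity ω, Function.support k ⊆ V :=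
  mem_inf_of_left (preimage_mem_comap (eventually_smallSets_subset.2 hV))

theorem support_conv_e (t : K) : (conv t e : Measure K).support = {t} := by
  refine (support_nonempty t e).subset_singleton_iff.1 fun s hs => ?_
  rw [conv_e] at hs
  by_contra hne
  have := (Measure.mem_support_iff_forall _).1 hs {t}ᶜ (isOpen_compl_singleton.mem_nhds hne)
  simp at this

theorem eventually_forall_dist_lt {Y : Type*} [PseudoMetricSpace Y] {f : K → Y}
    (hf : Continuous f) {Q : Set K} (hQ : IsCompact Q) {ε : ℝ} (hε : 0 < ε) :
    ∀ᶠ v in 𝓝 (e : K), ∀ t ∈ Q, ∀ s ∈ (conv t v : Measure K).support, dist (f s) (f t) < ε := by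
  refine hQ.eventually_forall_of_forall_eventually fun t _ => ?_
  have hW : IsOpen (f ⁻¹' Metric.ball (f t) (ε / 2)) := Metric.isOpen_ball.preimage hf
  have htW : t ∈ f ⁻¹' Metric.ball (f t) (ε / 2) := Metric.mem_ball_self (half_pos hε)
  have hsupp : ∀ᶠ p : K × K in 𝓝 (e, t),
      (conv p.2 p.1 : Measure K).support ⊆ f ⁻¹' Metric.ball (f t) (ε / 2) :=
    ((isOpen_support_subset hW).preimage continuous_swap).mem_nhds
      ((support_conv_e t).trans_subset (singleton_subset_iff.2 htW))
  have hpoint : ∀ᶠ p : K × K in 𝓝 (e, t), p.2 ∈ f ⁻¹' Metric.ball (f t) (ε / 2) :=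
    (hW.preimage continuous_snd).mem_nhds htW
  filter_upwards [hsupp, hpoint] with p hp1 hp2 s hs
  calc dist (f s) (f p.2) ≤ dist (f s) (f t) + dist (f p.2) (f t) := dist_triangle_right _ _ _
    _ < ε / 2 + ε / 2 := add_lt_add (hp1 hs) hp2
    _ = ε := add_halves ε

theorem IsLeftHaar.norm_smoothing_sub_le [CompleteSpace E] (hω : IsLeftHaar ω) {k : K → ℝ}
    (hk : IsSymmetricMollifier ω k) {f : K → E} (hf : LocallyIntegrable f ω) {t : K} {ε : ℝ}
    (h : ∀ v ∈ Function.support k, ∀ s ∈ (conv t v : Measure K).support, ‖f s - f t‖ ≤ ε) :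
    ‖smoothing ω k f t - f t‖ ≤ ε := by
  have := hω.regular
  have hkt := hk.toIsCcNonneg.realTrans (inv t)
  have hi : Integrable (realTrans k (inv t)) ω :=
    hkt.continuous.integrable_of_hasCompactSupport hkt.hasCompactSupport
  have hif : Integrable (fun s => realTrans k (inv t) s • f s) ω :=
    hf.integrable_smul_left_of_hasCompactSupport hkt.continuous hkt.hasCompactSupport
  have hmass : ∫ s, realTrans k (inv t) s ∂ω = 1 := by
    rw [hω.integral_realTrans hk.continuous hk.hasCompactSupport, hk.integral_eq_one]
  have hsub : smoothing ω k f t - f t = ∫ s, realTrans k (inv t) s • (f s - f t) ∂ω := by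
    simp_rw [smul_sub]
    rw [integral_sub hif (hi.smul_const _), integral_smul_const, hmass, one_smul, smoothing]
  rw [hsub, ← mul_one ε, ← hmass, ← integral_const_mul]
  refine norm_integral_le_of_norm_le (hi.const_mul ε) (.of_forall fun s => ?_)
  rw [norm_smul, Real.norm_of_nonneg (hkt.nonneg s), mul_comm ε]
  by_cases hs : realTrans k (inv t) s = 0
  · rw [hs, zero_mul, zero_mul]
  · obtain ⟨v, hv, hkv⟩ := exists_mem_support_of_realTrans_ne_zero hs
    have hst := mem_support_inv_left hv
    rw [inv_inv] at hst
    exact mul_le_mul_of_nonneg_left (h v hkv s hst) (hkt.nonneg s)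

theorem IsLeftHaar.tendstoUniformly_smoothing (hω : IsLeftHaar ω) {f : K → ℝ}
    (hf : Continuous f) (hfc : HasCompactSupport f) :
    TendstoUniformly (fun k => smoothing ω k f) f (approxIdentity ω) := by
  have := hω.regular
  obtain ⟨V, hV, hVe⟩ := exists_compact_mem_nhds (e : K)
  have hfV : Function.support f ⊆ setMul (tsupport f) V := fun t ht =>
    mem_setMul.2 ⟨t, subset_tsupport f ht, e, mem_of_mem_nhds hVe, by simp [support_conv_e]⟩
  rw [Metric.tendstoUniformly_iff]
  intro ε hε
  filter_upwards [eventually_isSymmetricMollifier, eventually_support_subset hVe,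
    eventually_support_subset (eventually_forall_dist_lt hf (isCompact_setMul hfc hV)
      (half_pos hε))] with k hk hkV hkf t
  by_cases ht : t ∈ setMul (tsupport f) V
  · rw [dist_comm, dist_eq_norm]
    refine (hω.norm_smoothing_sub_le hk hf.locallyIntegrable fun v hv s hs => ?_).trans_lt
      (half_lt_self hε)
    rw [← dist_eq_norm]
    exact (hkf hv t ht s hs).le
  · have hft : f t = 0 := Function.notMem_support.1 fun h => ht (hfV h)
    have hst : smoothing ω k f t = 0 := Function.notMem_support.1 fun h =>
      ht (setMul_mono (subset_tsupport f) hkV (support_smoothing_subset hk f h))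
    rwa [hft, hst, dist_self]

theorem integral_realTrans_leftTranslate [ω.Regular] {g k : K → ℝ} (hg : IsCcNonneg g)
    (hk : IsCcNonneg k) (x s : K) :
    ∫ t, realTrans k (inv s) t ∂leftTranslate (withRealDensity ω g) x =
      realTrans (smoothing ω k g) (inv x) s := by
  have := hg.isFiniteMeasure (ω := ω)
  have := hg.regular (ω := ω)
  have hF := isFellerKernel_leftTranslate (withRealDensity ω g)
  have := hF.isFiniteMeasure x
  have hkm := hk.continuous.stronglyMeasurable_of_hasCompactSupport hk.hasCompactSupport
  obtain ⟨C, hC⟩ := hk.hasCompactSupport.exists_bound_of_continuous hk.continuous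
  have hcont := continuous_smoothing hk.continuous hk.hasCompactSupport
    (hg.continuous.locallyIntegrable (μ := ω))
  calc ∫ t, realTrans k (inv s) t ∂leftTranslate (withRealDensity ω g) x
      = ∫ t, k t ∂leftTranslate (leftTranslate (withRealDensity ω g) x) (inv s) :=
        (integral_leftTranslate _ hkm hC _).symm
    _ = ∫ u, ∫ t, k t ∂leftTranslate (withRealDensity ω g) u ∂(conv (inv s) x : Measure K) := by
        rw [leftTranslate_leftTranslate, hF.integral_bind_of_bounded _ hkm hC]
    _ = ∫ u, smoothing ω k g (inv u) ∂(conv (inv s) x : Measure K) := by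
        refine integral_congr_ae (.of_forall fun u => ?_)
        beta_reduce
        rw [integral_leftTranslate _ hkm hC,
          integral_withRealDensity hg.continuous.measurable hg.nonneg, smoothing_inv]
        simp only [smul_eq_mul, mul_comm, realTrans]
    _ = realTrans (smoothing ω k g) (inv x) s := integral_comp_inv_conv hcont x s

theorem integral_smoothing_leftTranslate [ω.Regular] {f g k : K → ℝ} (hf : Continuous f)
    (hfc : HasCompactSupport f) (hg : IsCcNonneg g) (hk : IsSymmetricMollifier ω k) (x : K) :
    ∫ t, smoothing ω k f t ∂leftTranslate (withRealDensity ω g) x =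
      ∫ s, realTrans (smoothing ω k g) (inv x) s * f s ∂ω := by
  have := hg.isFiniteMeasure (ω := ω)
  have := hg.regular (ω := ω)
  have := (isFellerKernel_leftTranslate (withRealDensity ω g)).isFiniteMeasure x
  have hcont : Continuous (fun t s => realTrans k (inv s) t * f s).uncurry :=
    ((continuous_realTrans hk.continuous hk.hasCompactSupport).comp
      ((continuous_inv.comp continuous_snd).prodMk continuous_fst)).mul (hf.comp continuous_snd)
  have hsupp : HasCompactSupport (fun t s => realTrans k (inv s) t * f s).uncurry := by
    refine HasCompactSupport.intro
      ((isCompact_setMul hfc hk.hasCompactSupport).prod hfc) fun ⟨t, s⟩ hts => ?_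
    by_contra hne
    have hfs : s ∈ tsupport f := subset_tsupport f (right_ne_zero_of_mul hne)
    exact hts ⟨setMul_mono Subset.rfl (subset_tsupport k) (mem_setMul_of_realTrans_ne_zero
      (by rwa [inv_inv]) (left_ne_zero_of_mul hne)), hfs⟩
  calc ∫ t, smoothing ω k f t ∂leftTranslate (withRealDensity ω g) x
      = ∫ t, ∫ s, realTrans k (inv s) t * f s ∂ω ∂leftTranslate (withRealDensity ω g) x := by
        simp only [smoothing, smul_eq_mul, realTrans_inv_comm hk.continuous hk.symm _]
    _ = ∫ s, ∫ t, realTrans k (inv s) t * f s ∂leftTranslate (withRealDensity ω g) x ∂ω :=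
        integral_integral_swap_of_hasCompactSupport hcont hsupp
    _ = ∫ s, realTrans (smoothing ω k g) (inv x) s * f s ∂ω := by
        simp only [integral_mul_const, integral_realTrans_leftTranslate hg hk.toIsCcNonneg]

theorem eventually_continuous_hasCompactSupport_smoothing [ω.Regular] {f : K → ℝ}
    (hf : Continuous f) (hfc : HasCompactSupport f) : ∀ᶠ k in approxIdentity ω,
      Continuous (smoothing ω k f) ∧ HasCompactSupport (smoothing ω k f) := by
  filter_upwards [eventually_isSymmetricMollifier] with k hk
  exact ⟨continuous_smoothing hk.continuous hk.hasCompactSupport hf.locallyIntegrable,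
    hasCompactSupport_smoothing hk hfc⟩

theorem IsLeftHaar.tendsto_integral_smoothing (hω : IsLeftHaar ω) (ν : Measure K)
    [IsFiniteMeasure ν] {f : K → ℝ} (hf : Continuous f) (hfc : HasCompactSupport f) :
    Tendsto (fun k => ∫ t, smoothing ω k f t ∂ν) (approxIdentity ω) (𝓝 (∫ t, f t ∂ν)) := by
  have := hω.regular
  have h := tendsto_integral_smul_of_tendstoUniformly (u := fun _ => (1 : ℝ))
    (hω.tendstoUniformly_smoothing hf hfc) (integrable_const (μ := ν) _)
  simp only [smul_eq_mul, mul_one] at h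
  exact h ((eventually_continuous_hasCompactSupport_smoothing hf hfc).mono
    fun k hk => hk.1.integrable_of_hasCompactSupport hk.2) (hf.integrable_of_hasCompactSupport hfc)

theorem IsLeftHaar.tendsto_integral_realTrans_smoothing_mul (hω : IsLeftHaar ω) {f g : K → ℝ}
    (hf : Continuous f) (hfc : HasCompactSupport f) (hg : Continuous g)
    (hgc : HasCompactSupport g) (x : K) :
    Tendsto (fun k => ∫ s, realTrans (smoothing ω k g) x s * f s ∂ω) (approxIdentity ω)
      (𝓝 (∫ s, realTrans g x s * f s ∂ω)) := by
  have := hω.regular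
  have hCc := eventually_continuous_hasCompactSupport_smoothing (ω := ω) hg hgc
  have hmul : ∀ {h : K → ℝ}, Continuous h → HasCompactSupport h →
      Integrable (fun s => realTrans h x s * f s) ω := fun hh hhc =>
    ((continuous_realTrans_right hh hhc x).mul hf).integrable_of_hasCompactSupport hfc.mul_left
  exact tendsto_integral_smul_of_tendstoUniformly
    (tendstoUniformly_realTrans (hω.tendstoUniformly_smoothing hg hgc) hCc hg hgc x)
    (hf.integrable_of_hasCompactSupport hfc) (hCc.mono fun k hk => hmul hk.1 hk.2) (hmul hg hgc)

/- For mollified functions the adjoint relation between translations by `x` and `x̌` is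
associativity of the convolution; it passes to the limit along an approximate identity. -/
theorem IsLeftHaar.leftTranslate_withRealDensity (hω : IsLeftHaar ω) {g : K → ℝ}
    (hg : IsCcNonneg g) (x : K) :
    leftTranslate (withRealDensity ω g) x = withRealDensity ω (realTrans g (inv x)) := by
  have := hω.regular
  have := hω.neBot_approxIdentity
  have := hg.isFiniteMeasure (ω := ω)
  have := hg.regular (ω := ω)
  have := (hg.realTrans (inv x)).regular (ω := ω)
  have hF := isFellerKernel_leftTranslate (withRealDensity ω g)
  have := hF.isFiniteMeasure x
  have := hF.regular x
  refine ext_of_integral_eq_of_hasCompactSupport fun f hf hfc => ?_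
  rw [integral_withRealDensity (hg.realTrans _).continuous.measurable (hg.realTrans _).nonneg]
  refine tendsto_nhds_unique (hω.tendsto_integral_smoothing _ hf hfc)
    ((hω.tendsto_integral_realTrans_smoothing_mul hf hfc hg.continuous
      hg.hasCompactSupport (inv x)).congr' ?_)
  filter_upwards [eventually_isSymmetricMollifier] with k hk
  exact (integral_smoothing_leftTranslate hf hfc hg hk x).symm

end Smoothing

end Hypergroup

theorem ae_of_forall_ae_withRealDensity {X : Type*} [TopologicalSpace X] [T2Space X]
    [LocallyCompactSpace X] [SigmaCompactSpace X] [MeasurableSpace X] [OpensMeasurableSpace X]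
    {ω : Measure X} {p : X → Prop}
    (h : ∀ φ : X → ℝ, IsCcNonneg φ → ∀ᵐ x ∂withRealDensity ω φ, p x) : ∀ᵐ x ∂ω, p x := by
  have hn : ∀ n : ℕ, ∀ᵐ x ∂ω, x ∈ compactCovering X n → p x := fun n => by
    obtain ⟨φ, h1, -, hφc, h01⟩ := exists_continuous_one_zero_of_isCompact
      (isCompact_compactCovering X n) isClosed_empty (disjoint_empty _)
    have hφ := h φ ⟨φ.continuous, hφc, fun x => (h01 x).1⟩
    rw [withRealDensity, ae_withDensity_iff φ.continuous.measurable.ennreal_ofReal] at hφ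
    filter_upwards [hφ] with x hx hxn
    refine hx ?_
    rw [h1 hxn]
    simp
  filter_upwards [ae_all_iff.2 hn] with x hx
  obtain ⟨n, hn⟩ := mem_iUnion.1 ((iUnion_compactCovering X).symm ▸ mem_univ x)
  exact hx n hn

namespace Hypergroup

section Harmonic

variable {K : Type*} [TopologicalSpace K] [T2Space K] [LocallyCompactSpace K]
  [MeasurableSpace K] [BorelSpace K] [Hypergroup K]
  {E : Type*} [NormedAddCommGroup E] [NormedSpace ℝ E] {ω σ : Measure K}

/-- The involution as a homeomorphism. -/
def invHomeomorph : K ≃ₜ K where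
  toFun := inv
  invFun := inv
  left_inv := inv_inv
  right_inv := inv_inv
  continuous_toFun := continuous_inv
  continuous_invFun := continuous_inv

theorem regular_map_inv (σ : Measure K) [σ.Regular] : (σ.map inv).Regular :=
  Measure.Regular.map (invHomeomorph (K := K))

theorem integral_map_inv (σ : Measure K) (f : K → E) :
    ∫ y, f y ∂σ.map inv = ∫ y, f (inv y) ∂σ :=
  (invHomeomorph (K := K)).measurableEmbedding.integral_map f

/-- The kernel `s ↦ σ̌ * δ_s`, which represents the operator `f ↦ σ * f` of `convFun`. -/
noncomputable def convKernel (σ : Measure K) (s : K) : Measure K :=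
  (σ.map inv).bind fun y => (conv y s : Measure K)

instance isProbabilityMeasure_convKernel [IsProbabilityMeasure σ] (s : K) :
    IsProbabilityMeasure (convKernel σ s) := by
  have : IsProbabilityMeasure (σ.map inv) :=
    Measure.isProbabilityMeasure_map continuous_inv.measurable.aemeasurable
  refine ⟨?_⟩
  rw [convKernel, (isFellerKernel_conv_left s).bind_apply _ .univ]
  simp only [measure_univ, lintegral_const, mul_one]

theorem convFun_eq_integral_convKernel [IsFiniteMeasure σ] {f : K → ℂ} (hf : StronglyMeasurable f)
    {C : ℝ} (hC : ∀ x, ‖f x‖ ≤ C) (s : K) : convFun σ f s = ∫ t, f t ∂convKernel σ s := by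
  rw [convKernel, (isFellerKernel_conv_left s).integral_bind_of_bounded _ hf hC, integral_map_inv]
  rfl

section Feller

variable [IsFiniteMeasure σ] [σ.Regular]

theorem isFellerKernel_convKernel (σ : Measure K) [IsFiniteMeasure σ] [σ.Regular] :
    IsFellerKernel (convKernel σ) :=
  have := regular_map_inv σ
  have hswap : IsFellerKernel (Function.uncurry fun x y : K => (conv y x : Measure K)) :=
    isFellerKernel_conv.comp continuous_swap
  hswap.bind (σ.map inv)

section Bind

variable (ν : Measure K) [IsFiniteMeasure ν] [ν.Regular]

theorem bind_convKernel : ν.bind (convKernel σ) = (σ.map inv).bind (leftTranslate ν) :=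
  have := regular_map_inv σ
  (isFellerKernel_conv.bind_bind_comm (σ.map inv) ν).symm

theorem convKernel_bind (x : K) :
    (convKernel σ x).bind (leftTranslate ν) = (leftTranslate ν x).bind (convKernel σ) := by
  have hF := isFellerKernel_leftTranslate ν
  have := hF.isFiniteMeasure x
  have := hF.regular x
  rw [bind_convKernel, convKernel, Measure.bind_bind
    (isFellerKernel_conv_left x).measurable.aemeasurable hF.measurable.aemeasurable]
  exact congrArg _ (funext fun y => (leftTranslate_leftTranslate ν x y).symm)

end Bind

theorem IsLeftHaar.leftTranslate_absolutelyContinuous (hω : IsLeftHaar ω) {φ : K → ℝ}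
    (hφ : IsCcNonneg φ) (x : K) : leftTranslate (withRealDensity ω φ) x ≪ ω := by
  rw [hω.leftTranslate_withRealDensity hφ]
  exact withDensity_absolutelyContinuous _ _

theorem IsLeftHaar.ae_ae_convKernel [SigmaCompactSpace K] (hω : IsLeftHaar ω) {p : K → Prop}
    (h : ∀ᵐ x ∂ω, p x) : ∀ᵐ s ∂ω, ∀ᵐ x ∂convKernel σ s, p x := by
  have := hω.regular
  refine ae_of_forall_ae_withRealDensity fun φ hφ => ?_
  have := hφ.isFiniteMeasure (ω := ω)
  have := hφ.regular (ω := ω)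
  have hF := isFellerKernel_leftTranslate (withRealDensity ω φ)
  have hac : (σ.map inv).bind (leftTranslate (withRealDensity ω φ)) ≪ ω := by
    refine Measure.AbsolutelyContinuous.mk fun s hs hs0 => ?_
    simp only [hF.bind_apply _ hs, hω.leftTranslate_absolutelyContinuous hφ _ hs0, lintegral_zero]
  refine Measure.ae_ae_of_ae_bind (isFellerKernel_convKernel σ).measurable.aemeasurable ?_
  rw [bind_convKernel]
  exact hac.ae_le h

theorem IsLeftHaar.convFun_congr_ae [SigmaCompactSpace K] (hω : IsLeftHaar ω) {f g : K → ℂ}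
    (h : f =ᵐ[ω] g) : convFun σ f =ᵐ[ω] convFun σ g := by
  filter_upwards [hω.ae_ae_convKernel (σ := σ) h] with s hs
  have hconv := ae_of_ae_map continuous_inv.measurable.aemeasurable
    (Measure.ae_ae_of_ae_bind (isFellerKernel_conv_left s).measurable.aemeasurable hs)
  refine integral_congr_ae ?_
  filter_upwards [hconv] with y hy using integral_congr_ae hy

end Feller

section Smoothing

variable {φ : K → ℝ} {C : ℝ}

theorem IsLeftHaar.smoothing_eq_integral (hω : IsLeftHaar ω) (hφ : IsCcNonneg φ) (f : K → E)
    (x : K) : smoothing ω φ f x = ∫ t, f t ∂leftTranslate (withRealDensity ω φ) x := by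
  rw [hω.leftTranslate_withRealDensity hφ, integral_withRealDensity
    (hφ.realTrans _).continuous.measurable (hφ.realTrans _).nonneg, smoothing]

theorem IsLeftHaar.exists_norm_smoothing_le (hω : IsLeftHaar ω) (hφ : IsCcNonneg φ) {f : K → E}
    (hC : ∀ x, ‖f x‖ ≤ C) : ∃ B, ∀ x, ‖smoothing ω φ f x‖ ≤ B := by
  have := hω.regular
  have := hφ.isFiniteMeasure (ω := ω)
  have := hφ.regular (ω := ω)
  have hF := isFellerKernel_leftTranslate (withRealDensity ω φ)
  have := hF.isFiniteMeasure
  obtain ⟨M, hM⟩ := hF.bound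
  refine ⟨C * M, fun x => ?_⟩
  rw [hω.smoothing_eq_integral hφ]
  refine (norm_integral_le_of_norm_le_const (.of_forall hC)).trans ?_
  exact mul_le_mul_of_nonneg_left (ENNReal.toReal_le_coe_of_le_coe (hM x))
    ((norm_nonneg _).trans (hC x))

theorem IsLeftHaar.integral_smoothing_convKernel [IsFiniteMeasure σ] [σ.Regular]
    (hω : IsLeftHaar ω) (hφ : IsCcNonneg φ) {f : K → ℂ} (hf : StronglyMeasurable f)
    (hC : ∀ x, ‖f x‖ ≤ C) (hh : convFun σ f =ᵐ[ω] f) (x : K) :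
    ∫ u, smoothing ω φ f u ∂convKernel σ x = smoothing ω φ f x := by
  have := hω.regular
  have := hφ.isFiniteMeasure (ω := ω)
  have := hφ.regular (ω := ω)
  have hF := isFellerKernel_leftTranslate (withRealDensity ω φ)
  have hS := isFellerKernel_convKernel σ
  have := hF.isFiniteMeasure x
  have := hS.isFiniteMeasure x
  simp_rw [hω.smoothing_eq_integral hφ]
  rw [← hF.integral_bind_of_bounded _ hf hC, convKernel_bind,
    hS.integral_bind_of_bounded _ hf hC]
  refine integral_congr_ae ?_
  filter_upwards [(hω.leftTranslate_absolutelyContinuous hφ x).ae_le hh] with s hs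
  rw [← convFun_eq_integral_convKernel hf hC, hs]

end Smoothing

end Harmonic

end Hypergroup

theorem ae_eq_const_of_integral_norm_sq_eq {X : Type*} [MeasurableSpace X] {μ : Measure X}
    [IsProbabilityMeasure μ] {E : Type*} [NormedAddCommGroup E] [InnerProductSpace ℝ E]
    [CompleteSpace E] {F : X → E} (hF : MemLp F 2 μ) {c : E} (hmean : ∫ x, F x ∂μ = c)
    (hsq : ∫ x, ‖F x‖ ^ 2 ∂μ = ‖c‖ ^ 2) : ∀ᵐ x ∂μ, F x = c := by
  have hi : Integrable F μ := hF.integrable one_le_two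
  have hinner : Integrable (fun x => 2 * inner ℝ (F x) c) μ := (hi.inner_const c).const_mul 2
  have hnorm : Integrable (fun x => ‖F x‖ ^ 2) μ := hF.integrable_norm_pow two_ne_zero
  have hdiff : Integrable (fun x => ‖F x - c‖ ^ 2) μ :=
    (hF.sub (memLp_const c)).integrable_norm_pow two_ne_zero
  have hcross : ∫ x, inner ℝ (F x) c ∂μ = ‖c‖ ^ 2 := by
    simp only [real_inner_comm c]
    rw [integral_inner hi, hmean, real_inner_self_eq_norm_sq]
  have hsub : Integrable (fun x => ‖F x‖ ^ 2 - 2 * inner ℝ (F x) c) μ := hnorm.sub hinner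
  have hvar : ∫ x, ‖F x - c‖ ^ 2 ∂μ = 0 := by
    simp only [norm_sub_sq_real]
    rw [integral_add hsub (integrable_const _), integral_sub hnorm hinner,
      integral_const_mul, hcross, hsq, integral_const, probReal_univ, one_smul]
    ring
  filter_upwards [(integral_eq_zero_iff_of_nonneg (fun x => sq_nonneg _) hdiff).1 hvar] with x hx
  exact sub_eq_zero.1 (norm_eq_zero.1 (sq_eq_zero_iff.1 hx))

section Orthogonal

variable {X : Type*} [TopologicalSpace X] [T2Space X] [LocallyCompactSpace X]
  [MeasurableSpace X] [BorelSpace X] {ω : Measure X} [ω.Regular]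

theorem exists_isCcNonneg_integral_indicator_sub_le {Q : Set X} (hQ : IsCompact Q) {ε : ℝ}
    (hε : 0 < ε) : ∃ ψ, IsCcNonneg ψ ∧ ∫ x, ‖Q.indicator 1 x - ψ x‖ ∂ω ≤ ε := by
  have hQm := hQ.measurableSet
  obtain ⟨U, hQU, hU, hωU⟩ := hQ.exists_isOpen_lt_of_lt (μ := ω) (ω Q + ENNReal.ofReal ε)
    (ENNReal.lt_add_right hQ.measure_lt_top.ne (by simpa using hε))
  obtain ⟨ψ, hone, hzero, hψc, hψ01⟩ := exists_continuous_one_zero_of_isCompact hQ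
    hU.isClosed_compl (disjoint_compl_right_iff_subset.2 hQU)
  have hdiff : ω (U \ Q) < ENNReal.ofReal ε := by
    rw [measure_sdiff hQU hQm.nullMeasurableSet hQ.measure_lt_top.ne]
    exact ENNReal.sub_lt_of_lt_add (measure_mono hQU) (by rwa [add_comm])
  have hUQ : MeasurableSet (U \ Q) := hU.measurableSet.diff hQm
  refine ⟨ψ, ⟨ψ.continuous, hψc, fun x => (hψ01 x).1⟩, ?_⟩
  calc ∫ x, ‖Q.indicator 1 x - ψ x‖ ∂ω
      ≤ ∫ x, (U \ Q).indicator 1 x ∂ω := by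
        refine integral_mono_of_nonneg (.of_forall fun x => norm_nonneg _)
          ((integrable_indicator_iff hUQ).2 (integrableOn_const hdiff.ne_top))
          (.of_forall fun x => ?_)
        by_cases hxQ : x ∈ Q
        · simp [hxQ, hone hxQ]
        by_cases hxU : x ∈ U
        · simpa [hxQ, hxU, abs_of_nonneg (hψ01 x).1] using (hψ01 x).2
        · simp [hxQ, hxU, hzero hxU]
    _ = ω.real (U \ Q) := integral_indicator_one hUQ
    _ ≤ ε := (ENNReal.toReal_lt_of_lt_ofReal hdiff).le

theorem ae_eq_zero_of_forall_integral_smul_eq_zero [SigmaCompactSpace X] {E : Type*}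
    [NormedAddCommGroup E] [NormedSpace ℝ E] [CompleteSpace E] {h : X → E}
    (hh : LocallyIntegrable h ω) {C : ℝ} (hC : ∀ x, ‖h x‖ ≤ C)
    (h0 : ∀ ψ : X → ℝ, IsCcNonneg ψ → ∫ x, ψ x • h x ∂ω = 0) : h =ᵐ[ω] 0 := by
  refine ae_eq_zero_of_forall_setIntegral_isCompact_eq_zero' hh fun Q hQ => ?_
  rcases isEmpty_or_nonempty X with hX | ⟨⟨x₀⟩⟩
  · exact integral_of_isEmpty
  have hC0 : 0 ≤ C := (norm_nonneg _).trans (hC x₀)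
  have hQi : Integrable (Q.indicator (1 : X → ℝ)) ω :=
    (integrable_indicator_iff hQ.measurableSet).2 (integrableOn_const hQ.measure_lt_top.ne)
  have hQsmul : ∀ x, Q.indicator h x = Q.indicator (1 : X → ℝ) x • h x := fun x => by
    by_cases hx : x ∈ Q <;> simp [hx]
  have hQh : Integrable (fun x => Q.indicator (1 : X → ℝ) x • h x) ω := by
    simp only [← hQsmul]
    exact (integrable_indicator_iff hQ.measurableSet).2 (hh.integrableOn_isCompact hQ)
  refine norm_le_zero_iff.1 (le_of_forall_pos_le_add fun ε hε => ?_)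
  obtain ⟨ψ, hψ, hψε⟩ := exists_isCcNonneg_integral_indicator_sub_le (ω := ω) hQ
    (ε := ε / (C + 1)) (by positivity)
  have hψi := hψ.continuous.integrable_of_hasCompactSupport hψ.hasCompactSupport (μ := ω)
  have hψh : Integrable (fun x => ψ x • h x) ω :=
    hh.integrable_smul_left_of_hasCompactSupport hψ.continuous hψ.hasCompactSupport
  calc ‖∫ x in Q, h x ∂ω‖
      = ‖∫ x, (Q.indicator 1 x - ψ x) • h x ∂ω‖ := by
        simp only [sub_smul]
        rw [integral_sub hQh hψh, h0 ψ hψ, sub_zero, ← integral_indicator hQ.measurableSet]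
        simp only [hQsmul]
    _ ≤ ∫ x, ‖Q.indicator 1 x - ψ x‖ * C ∂ω :=
        norm_integral_le_of_norm_le ((hQi.sub hψi).norm.mul_const C) (.of_forall fun x => by
          rw [norm_smul]
          exact mul_le_mul_of_nonneg_left (hC x) (norm_nonneg _))
    _ ≤ ε / (C + 1) * C := by
        rw [integral_mul_const]
        exact mul_le_mul_of_nonneg_right hψε hC0
    _ ≤ 0 + ε := by
        rw [zero_add, div_mul_eq_mul_div, div_le_iff₀ (by positivity)]
        exact mul_le_mul_of_nonneg_left (le_add_of_nonneg_right zero_le_one) hε.le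

end Orthogonal

theorem locallyIntegrable_of_bounded {X : Type*} [TopologicalSpace X] [MeasurableSpace X]
    {μ : Measure X} [IsLocallyFiniteMeasure μ] {E : Type*} [NormedAddCommGroup E] {f : X → E}
    (hf : AEStronglyMeasurable f μ) {C : ℝ} (hC : ∀ x, ‖f x‖ ≤ C) : LocallyIntegrable f μ :=
  (memLp_top_of_bound hf C (.of_forall hC)).locallyIntegrable le_top

theorem LInfty.coeFn_smul_one {X : Type*} [MeasurableSpace X] {ω : Measure X} (c : ℂ) :
    (c • (1 : Lp ℂ ∞ ω) : Lp ℂ ∞ ω) =ᵐ[ω] fun _ => c := by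
  filter_upwards [Lp.coeFn_smul c (1 : Lp ℂ ∞ ω), LInfty.coeFn_one (ω := ω)] with x hsmul hone
  rw [hsmul, Pi.smul_apply, hone, smul_eq_mul, mul_one]

theorem LInfty.exists_bounded_representative {X : Type*} [MeasurableSpace X] {ω : Measure X}
    (f : Lp ℂ ∞ ω) : ∃ g : X → ℂ, StronglyMeasurable g ∧ (∃ C, ∀ x, ‖g x‖ ≤ C) ∧ f =ᵐ[ω] g := by
  set B := lpNorm f ∞ ω
  have hs : MeasurableSet {x | ‖f x‖ ≤ B} :=
    (Lp.stronglyMeasurable f).norm.measurable measurableSet_Iic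
  refine ⟨{x | ‖f x‖ ≤ B}.indicator f, (Lp.stronglyMeasurable f).indicator hs, ⟨B, fun x => ?_⟩, ?_⟩
  · by_cases hx : ‖f x‖ ≤ B
    · simp [hx]
    · simp [hx, B, lpNorm_nonneg]
  · filter_upwards [ae_le_lpNorm_exponent_top (Lp.memLp f)] with x hx
    exact (indicator_of_mem (s := {x | ‖f x‖ ≤ B}) hx _).symm

namespace Hypergroup

variable {K : Type*} [TopologicalSpace K] [T2Space K] [LocallyCompactSpace K]
  [MeasurableSpace K] [BorelSpace K] [Hypergroup K] {ω σ : Measure K}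

section Smoothing

variable {E : Type*} [NormedAddCommGroup E] [NormedSpace ℝ E]

theorem IsLeftHaar.bind_leftTranslate_withRealDensity (hω : IsLeftHaar ω) {k ψ : K → ℝ}
    (hk : IsSymmetricMollifier ω k) (hψ : IsCcNonneg ψ) :
    (withRealDensity ω ψ).bind (leftTranslate (withRealDensity ω k)) =
      withRealDensity ω (smoothing ω k ψ) := by
  have := hω.regular
  have hkψ := isCcNonneg_smoothing hk hψ
  have := hk.toIsCcNonneg.isFiniteMeasure (ω := ω)
  have := hk.toIsCcNonneg.regular (ω := ω)
  have := hψ.isFiniteMeasure (ω := ω)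
  have := hψ.regular (ω := ω)
  have := hkψ.regular (ω := ω)
  have hF := isFellerKernel_leftTranslate (withRealDensity ω k)
  have := hF.regular_bind (withRealDensity ω ψ)
  have := hF.isFiniteMeasure_bind (withRealDensity ω ψ)
  refine ext_of_integral_eq_of_hasCompactSupport fun g hg hgc => ?_
  have h := integral_smoothing_leftTranslate hg hgc hψ hk e
  rw [leftTranslate_e, inv_e, realTrans_e] at h
  rw [hF.integral_bind_of_hasCompactSupport _ hg hgc,
    integral_withRealDensity hkψ.continuous.measurable hkψ.nonneg]
  simpa only [hω.smoothing_eq_integral hk.toIsCcNonneg, smul_eq_mul] using h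

theorem IsLeftHaar.integral_smul_smoothing (hω : IsLeftHaar ω) {k ψ : K → ℝ}
    (hk : IsSymmetricMollifier ω k) (hψ : IsCcNonneg ψ) {f : K → E} (hf : StronglyMeasurable f)
    {C : ℝ} (hC : ∀ x, ‖f x‖ ≤ C) :
    ∫ x, ψ x • smoothing ω k f x ∂ω = ∫ x, smoothing ω k ψ x • f x ∂ω := by
  have := hω.regular
  have hkψ := isCcNonneg_smoothing hk hψ
  have := hk.toIsCcNonneg.isFiniteMeasure (ω := ω)
  have := hk.toIsCcNonneg.regular (ω := ω)
  have := hψ.isFiniteMeasure (ω := ω)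
  rw [← integral_withRealDensity hkψ.continuous.measurable hkψ.nonneg,
    ← hω.bind_leftTranslate_withRealDensity hk hψ,
    (isFellerKernel_leftTranslate _).integral_bind_of_bounded _ hf hC,
    integral_withRealDensity hψ.continuous.measurable hψ.nonneg]
  simp only [hω.smoothing_eq_integral hk.toIsCcNonneg]

theorem IsLeftHaar.tendsto_integral_smoothing_smul (hω : IsLeftHaar ω) {ψ : K → ℝ}
    (hψ : Continuous ψ) (hψc : HasCompactSupport ψ) {f : K → E} (hf : LocallyIntegrable f ω) :
    Tendsto (fun k => ∫ x, smoothing ω k ψ x • f x ∂ω) (approxIdentity ω)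
      (𝓝 (∫ x, ψ x • f x ∂ω)) := by
  have := hω.regular
  obtain ⟨V, hV, hVe⟩ := exists_compact_mem_nhds (e : K)
  set Q := setMul (tsupport ψ) V
  have hQ : IsCompact Q := isCompact_setMul hψc hV
  have hindicator : ∀ q : K → ℝ, Function.support q ⊆ Q →
      (fun x => q x • f x) = fun x => q x • Q.indicator f x := fun q hq => by
    ext x
    by_cases hx : x ∈ Q
    · rw [indicator_of_mem hx]
    · rw [Function.notMem_support.1 fun h => hx (hq h), zero_smul, zero_smul]
  have hψQ : Function.support ψ ⊆ Q := (subset_tsupport ψ).trans fun x hx =>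
    mem_setMul.2 ⟨x, hx, e, mem_of_mem_nhds hVe, (support_conv_e x).symm ▸ rfl⟩
  have hkQ : ∀ᶠ k in approxIdentity ω, Function.support (smoothing ω k ψ) ⊆ Q := by
    filter_upwards [eventually_isSymmetricMollifier, eventually_support_subset hVe] with k hk hkV
    exact (support_smoothing_subset hk ψ).trans (setMul_mono (subset_tsupport ψ) hkV)
  have hint : ∀ {q : K → ℝ}, Continuous q → HasCompactSupport q → Function.support q ⊆ Q →
      Integrable (fun x => q x • Q.indicator f x) ω := fun {q} hq hqc hqQ => by
    rw [← hindicator q hqQ]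
    exact hf.integrable_smul_left_of_hasCompactSupport hq hqc
  have htendsto := tendsto_integral_smul_of_tendstoUniformly
    (hω.tendstoUniformly_smoothing hψ hψc)
    ((integrable_indicator_iff hQ.measurableSet).2 (hf.integrableOn_isCompact hQ))
    (by
      filter_upwards [eventually_continuous_hasCompactSupport_smoothing hψ hψc, hkQ] with k hk hkQ
      exact hint hk.1 hk.2 hkQ)
    (hint hψ hψc hψQ)
  rw [← hindicator ψ hψQ] at htendsto
  exact htendsto.congr' (hkQ.mono fun k hk => by rw [← hindicator _ hk])

/- Both sides are limits along the approximate identity: `ψ ↦ ∫ ψ f` is the limit of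
`ψ ↦ (∫ ψ) m_k`, where `m_k` is the constant value of the smoothing of `f` by `k`, and testing
against one mollifier shows that the `m_k` converge. -/
theorem IsLeftHaar.exists_integral_smul_eq_of_smoothing [CompleteSpace E] (hω : IsLeftHaar ω)
    {f : K → E} (hf : StronglyMeasurable f) {C : ℝ} (hC : ∀ x, ‖f x‖ ≤ C)
    (hconst : ∀ φ : K → ℝ, IsCcNonneg φ → ∀ x, smoothing ω φ f x = smoothing ω φ f e) :
    ∃ c : E, ∀ ψ : K → ℝ, IsCcNonneg ψ → ∫ x, ψ x • f x ∂ω = (∫ x, ψ x ∂ω) • c := by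
  have := hω.regular
  have := hω.neBot_approxIdentity
  have hloc : LocallyIntegrable f ω := locallyIntegrable_of_bounded hf.aestronglyMeasurable hC
  obtain ⟨ψ₀, hψ₀, -⟩ := hω.exists_isSymmetricMollifier (univ_mem (f := 𝓝 (e : K)))
  have hlim : ∀ ψ : K → ℝ, IsCcNonneg ψ → Tendsto (fun k => (∫ x, ψ x ∂ω) • smoothing ω k f e)
      (approxIdentity ω) (𝓝 (∫ x, ψ x • f x ∂ω)) := fun ψ hψ => by
    refine (hω.tendsto_integral_smoothing_smul hψ.continuous hψ.hasCompactSupport hloc).congr' ?_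
    filter_upwards [eventually_isSymmetricMollifier] with k hk
    rw [← hω.integral_smul_smoothing hk hψ hf hC]
    simp only [hconst k hk.toIsCcNonneg, integral_smul_const]
  have hmean := hlim ψ₀ hψ₀.toIsCcNonneg
  simp only [hψ₀.integral_eq_one, one_smul] at hmean
  exact ⟨_, fun ψ hψ => tendsto_nhds_unique (hlim ψ hψ) (hmean.const_smul _)⟩

theorem IsLeftHaar.ae_eq_const_of_smoothing [CompleteSpace E] [SigmaCompactSpace K]
    (hω : IsLeftHaar ω) {f : K → E} (hf : StronglyMeasurable f) {C : ℝ} (hC : ∀ x, ‖f x‖ ≤ C)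
    (hconst : ∀ φ : K → ℝ, IsCcNonneg φ → ∀ x, smoothing ω φ f x = smoothing ω φ f e) :
    ∃ c : E, f =ᵐ[ω] fun _ => c := by
  have := hω.regular
  have hloc : LocallyIntegrable f ω := locallyIntegrable_of_bounded hf.aestronglyMeasurable hC
  obtain ⟨c, hc⟩ := hω.exists_integral_smul_eq_of_smoothing hf hC hconst
  refine ⟨c, ?_⟩
  have hsub : (fun x => f x - c) =ᵐ[ω] 0 := by
    refine ae_eq_zero_of_forall_integral_smul_eq_zero (hloc.sub (locallyIntegrable_const c))
      (C := C + ‖c‖) (fun x => (norm_sub_le _ _).trans (add_le_add_left (hC x) _)) fun ψ hψ => ?_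
    have hi := hψ.continuous.integrable_of_hasCompactSupport hψ.hasCompactSupport (μ := ω)
    simp only [smul_sub]
    rw [integral_sub (hloc.integrable_smul_left_of_hasCompactSupport hψ.continuous
      hψ.hasCompactSupport) (hi.smul_const c), integral_smul_const, hc ψ hψ, sub_self]
  filter_upwards [hsub] with x hx using sub_eq_zero.1 hx

end Smoothing

section Rigidity

theorem continuous_integral_convKernel [IsFiniteMeasure σ] [σ.Regular] {G : K → ℝ}
    (hG : Continuous G) {C : ℝ} (hC : ∀ x, ‖G x‖ ≤ C) :
    Continuous fun x => ∫ t, G t ∂convKernel σ x := by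
  have := regular_map_inv σ
  simp_rw [convKernel, fun x => (isFellerKernel_conv_left x).integral_bind_of_bounded (σ.map inv)
    hG.stronglyMeasurable hC]
  refine continuous_integral_of_bounded (σ.map inv)
    (G := fun x y => ∫ t, G t ∂(conv y x : Measure K)) (M := C)
    ((continuous_integral_conv hG hC).comp continuous_swap) fun x y => ?_
  simpa using norm_integral_le_of_norm_le_const (μ := (conv y x : Measure K)) (.of_forall hC)

theorem IsNondegenerate.eq_const [σ.Regular] (hσ : IsNondegenerate σ) {Y : Type*}
    [TopologicalSpace Y] [T2Space Y] {F : K → Y} (hF : Continuous F)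
    (h : ∀ x, ∀ᵐ t ∂convKernel σ x, F t = F x) (x : K) : F x = F e := by
  have := regular_map_inv σ
  have hstep : ∀ x, ∀ y ∈ σ.support, ∀ t ∈ (conv (inv y) x : Measure K).support, F t = F x := by
    intro x y hy t ht
    by_contra hne
    have hU : IsOpen {t | F t ≠ F x} := isOpen_ne_fun hF continuous_const
    refine ((isFellerKernel_conv_left x).measure_bind_pos_iff (σ.map inv) hU).2
      ⟨inv y, mem_support_map continuous_inv hy, ?_⟩ |>.ne' (h x)
    exact (measure_pos_iff_support_inter_nonempty hU).2 ⟨t, ht, hne⟩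
  have hpow : ∀ n, ∀ x ∈ setPow σ.support n, F (inv x) = F e := by
    intro n
    induction n with
    | zero =>
      rintro x rfl
      rw [inv_e]
    | succ n ih =>
      intro x hx
      obtain ⟨a, ha, b, hb, hab⟩ := mem_setMul.1 hx
      rw [hstep _ b hb _ (inv_mem_support hab), ih a ha]
  have hclosed : IsClosed {x | F (inv x) = F e} :=
    isClosed_eq (hF.comp continuous_inv) continuous_const
  have hall : inv x ∈ {x | F (inv x) = F e} :=
    closure_minimal (iUnion₂_subset fun n _ => hpow n) hclosed (hσ ▸ mem_univ (inv x))
  simpa only [mem_ofPred_eq, inv_inv] using hall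

section Subalgebra

variable [IsProbabilityMeasure σ]

theorem convFun_const (c : ℂ) : convFun σ (fun _ : K => c) = fun _ => c := by
  ext x
  simp [convFun, trans]

variable [σ.Regular] [SigmaCompactSpace K]

theorem IsLeftHaar.mem_harmonicLInfty_iff (hω : IsLeftHaar ω) {u : Lp ℂ ∞ ω} {F : K → ℂ}
    (h : u =ᵐ[ω] F) : u ∈ harmonicLInfty ω σ ↔ convFun σ F =ᵐ[ω] F := by
  have hc := hω.convFun_congr_ae (σ := σ) h
  exact ⟨fun hu => hc.symm.trans (EventuallyEq.trans (g := u) hu h),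
    fun hF => show convFun σ u =ᵐ[ω] u from hc.trans (hF.trans h.symm)⟩

theorem IsLeftHaar.smul_one_mem_harmonicLInfty (hω : IsLeftHaar ω) (c : ℂ) :
    c • (1 : Lp ℂ ∞ ω) ∈ harmonicLInfty ω σ := by
  rw [hω.mem_harmonicLInfty_iff (LInfty.coeFn_smul_one c), convFun_const]

theorem IsLeftHaar.toLp_mem_harmonicLInfty (hω : IsLeftHaar ω) {F : K → ℂ}
    (hF : StronglyMeasurable F) {C : ℝ} (hC : ∀ x, ‖F x‖ ≤ C) (hFω : MemLp F ∞ ω)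
    (hh : ∀ x, ∫ t, F t ∂convKernel σ x = F x) : hFω.toLp ∈ harmonicLInfty ω σ :=
  (hω.mem_harmonicLInfty_iff hFω.coeFn_toLp).2 <| .of_forall fun x => by
    rw [convFun_eq_integral_convKernel hF hC, hh]

variable {A : NonUnitalSubalgebra ℂ (Lp ℂ ∞ ω)} {F : K → ℂ} {C : ℝ}

theorem IsLeftHaar.convFun_norm_sq_ae_eq (hω : IsLeftHaar ω)
    (hA : (A : Set (Lp ℂ ∞ ω)) = harmonicLInfty ω σ) (hF : StronglyMeasurable F)
    (hC : ∀ x, ‖F x‖ ≤ C) (hh : ∀ x, ∫ t, F t ∂convKernel σ x = F x) :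
    convFun σ (fun x => ((‖F x‖ ^ 2 : ℝ) : ℂ)) =ᵐ[ω] fun x => ((‖F x‖ ^ 2 : ℝ) : ℂ) := by
  have hconjF : StronglyMeasurable fun x => conj (F x) :=
    Complex.continuous_conj.comp_stronglyMeasurable hF
  have hconjC : ∀ x, ‖conj (F x)‖ ≤ C := fun x => by rw [RCLike.norm_conj]; exact hC x
  have hFω : MemLp F ∞ ω := memLp_top_of_bound hF.aestronglyMeasurable C (.of_forall hC)
  have hconjω : MemLp (fun x => conj (F x)) ∞ ω :=
    memLp_top_of_bound hconjF.aestronglyMeasurable C (.of_forall hconjC)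
  have hmem : hFω.toLp ∈ A := by
    rw [← SetLike.mem_coe, hA]
    exact hω.toLp_mem_harmonicLInfty hF hC hFω hh
  have hconjmem : hconjω.toLp ∈ A := by
    rw [← SetLike.mem_coe, hA]
    exact hω.toLp_mem_harmonicLInfty hconjF hconjC hconjω fun x => by rw [integral_conj, hh]
  have hmul : hFω.toLp * hconjω.toLp ∈ A := mul_mem hmem hconjmem
  have hrep : (hFω.toLp * hconjω.toLp : Lp ℂ ∞ ω) =ᵐ[ω] fun x => ((‖F x‖ ^ 2 : ℝ) : ℂ) := by
    filter_upwards [LInfty.coeFn_mul hFω.toLp hconjω.toLp, hFω.coeFn_toLp, hconjω.coeFn_toLp]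
      with x hprod hFx hconjx
    rw [hprod, hFx, hconjx, Complex.mul_conj, Complex.normSq_eq_norm_sq]
  rwa [← SetLike.mem_coe, hA, hω.mem_harmonicLInfty_iff hrep] at hmul

theorem IsLeftHaar.integral_norm_sq_convKernel (hω : IsLeftHaar ω)
    (hA : (A : Set (Lp ℂ ∞ ω)) = harmonicLInfty ω σ) (hF : Continuous F) (hC : ∀ x, ‖F x‖ ≤ C)
    (hh : ∀ x, ∫ t, F t ∂convKernel σ x = F x) (x : K) :
    ∫ t, ‖F t‖ ^ 2 ∂convKernel σ x = ‖F x‖ ^ 2 := by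
  have := hω.isOpenPosMeasure
  have hG : Continuous fun x => ‖F x‖ ^ 2 := hF.norm.pow 2
  have hGC : ∀ x, ‖‖F x‖ ^ 2‖ ≤ C ^ 2 := fun x => by
    rw [norm_pow, norm_norm]
    exact pow_le_pow_left₀ (norm_nonneg _) (hC x) 2
  refine congrFun (((continuous_integral_convKernel hG hGC).ae_eq_iff_eq (μ := ω) hG).1 ?_) x
  filter_upwards [hω.convFun_norm_sq_ae_eq hA hF.stronglyMeasurable hC hh] with x hx
  rw [convFun_eq_integral_convKernel
    (Complex.continuous_ofReal.comp_stronglyMeasurable hG.stronglyMeasurable) (C := C ^ 2)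
    (fun x => by rw [Complex.norm_real]; exact hGC x), integral_complex_ofReal] at hx
  exact_mod_cast hx

theorem IsNondegenerate.eq_const_of_subalgebra (hσ : IsNondegenerate σ) (hω : IsLeftHaar ω)
    (hA : (A : Set (Lp ℂ ∞ ω)) = harmonicLInfty ω σ) (hF : Continuous F) (hC : ∀ x, ‖F x‖ ≤ C)
    (hh : ∀ x, ∫ t, F t ∂convKernel σ x = F x) (x : K) : F x = F e :=
  hσ.eq_const hF (fun x => ae_eq_const_of_integral_norm_sq_eq
    (MemLp.of_bound hF.stronglyMeasurable.aestronglyMeasurable C (.of_forall hC)) (hh x)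
    (hω.integral_norm_sq_convKernel hA hF hC hh x)) x

end Subalgebra

end Rigidity

end Hypergroup

theorem mainTheorem6 {K : Type*} [TopologicalSpace K] [T2Space K] [LocallyCompactSpace K]
    [MeasurableSpace K] [BorelSpace K] [Hypergroup K]
    (ω : Measure K) (hω : Hypergroup.IsLeftHaar ω)
    (σ : Measure K) [IsProbabilityMeasure σ] [σ.Regular]
    (hσ : Hypergroup.IsNondegenerate σ) :
    (∃ A : NonUnitalSubalgebra ℂ (Lp ℂ ∞ ω),
        (A : Set (Lp ℂ ∞ ω)) = Hypergroup.harmonicLInfty ω σ) ↔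
      Hypergroup.harmonicLInfty ω σ = Set.range fun c : ℂ => c • (1 : Lp ℂ ∞ ω) := by
  have := hσ.sigmaCompactSpace
  have := hω.regular
  constructor
  · rintro ⟨A, hA⟩
    refine Set.Subset.antisymm (fun f hf => ?_)
      (Set.range_subset_iff.2 fun c => hω.smul_one_mem_harmonicLInfty c)
    obtain ⟨g, hg, ⟨C, hC⟩, hfg⟩ := LInfty.exists_bounded_representative f
    have hharm := (hω.mem_harmonicLInfty_iff hfg).1 hf
    obtain ⟨c, hgc⟩ := hω.ae_eq_const_of_smoothing hg hC fun φ hφ => by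
      obtain ⟨B, hB⟩ := hω.exists_norm_smoothing_le hφ hC
      have hF := Hypergroup.continuous_smoothing hφ.continuous hφ.hasCompactSupport
        (locallyIntegrable_of_bounded (μ := ω) hg.aestronglyMeasurable hC)
      exact hσ.eq_const_of_subalgebra hω hA hF hB
        (hω.integral_smoothing_convKernel hφ hg hC hharm)
    exact ⟨c, Lp.ext ((LInfty.coeFn_smul_one c).trans (hfg.trans hgc).symm)⟩
  · intro h
    refine ⟨(⊥ : Subalgebra ℂ (Lp ℂ ∞ ω)).toNonUnitalSubalgebra, ?_⟩
    rw [h]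
    ext f
    simp [Algebra.mem_bot, Algebra.algebraMap_eq_smul_one]
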